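/- Let $k$ be a field. Graded algebras are $k$-algebras, modules are right modules unless stated otherwise, $A^o$ is the opposite algebra of $A$, and $A^e=A^o\otimes_kA$. $\operatorname{GrMod}A$ is the category of $\mathbb Z$-graded $A$-modules with degree-preserving homomorphisms. For graded $M$ put $M(\ell)_i=M_{\ell+i}$ and $(DM)_i=\operatorname{Hom}_k(M_{-i},k)$, and let $\underline{\operatorname{Hom}}_A(M,N)=\bigoplus_{n\in\mathbb Z}\operatorname{Hom}_{\operatorname{GrMod}A}(M,N(n))$. Let $A=\bigoplus_{i\ge 0}A_i$ be a locally finite $\mathbb N$-graded algebra (that is, $\dim_kA_i<\infty$ for all $i$), let $R=A_0$, regarded also as the graded $A$-$A$-bimodule $A/A_{\ge1}$, and let $\mathfrak m=A_{\ge1}$. Let $\underline\Gamma_{\mathfrak m}(M)=\varinjlim_n\underline{\operatorname{Hom}}_A(A/A_{\ge n},M)$. Both $\underline\Gamma_{\mathfrak m}$ and $\underline{\operatorname{Hom}}_A(R,-)$ are functors from $\operatorname{GrMod}A^e$ to itself, with right derived functors $R\underline\Gamma_{\mathfrak m}$ and $R\underline{\operatorname{Hom}}_A(R,-)$. An object of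 $\mathcal D(\operatorname{GrMod}A^e)$ is viewed in $\mathcal D(\operatorname{GrMod}A)$ and in $\mathcal D(\operatorname{GrMod}A^o)$ by forgetting the action of $A$ on the left, respectively on the right. Let $d\ge 0$ and $\ell$ be integers. * $A$ is ASF-regular of dimension $d$ and of Gorenstein parameter $\ell$ if $\operatorname{gldim}R<\infty$, $\operatorname{gldim}A=d$, and $R\underline\Gamma_{\mathfrak m}(A)\cong DA(\ell)[-d]$ in $\mathcal D(\operatorname{GrMod}A)$ and in $\mathcal D(\operatorname{GrMod}A^o)$. * $A$ is AS-regular over $R$ of dimension $d$ and of Gorenstein parameter $\ell$ if $\operatorname{gldim}R<\infty$, $\operatorname{gldim}A=d$, and $R\underline{\operatorname{Hom}}_A(R,A)\cong DR(\ell)[-d]$ in $\mathcal D(\operatorname{GrMod}A)$ and in $\mathcal D(\operatorname{GrMod}A^o)$. * $A$ satisfies (EF) if every finite-dimensional graded right $A$-module $M$ is graded right coherent, that is, $M$ is finitely generated and every finitely generated graded submodule of $M$ is finitely presented. **Theorem.** If $A$ is ASF-regular of dimension $d$ and of Gorenstein parameter $\ell$ and satisfies (EF), then $A$ is AS-regular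 over $R=A_0$ of dimension $d$ and of Gorenstein parameter $\ell$. -/

import Mathlib

open CategoryTheory CategoryTheory.Limits

universe u

noncomputable section

namespace ASReg

/-! ## Graded bimodules

Throughout `k` is a field and a graded `k`-algebra is a `k`-algebra `A` with a family
`𝒜 : ℤ → Submodule k A` of homogeneous components. -/

section Grading

variable {k : Type u} [Field k] {A : Type u} [Ring A] [Algebra k A]
  (𝒜 : ℤ → Submodule k A) [SetLike.GradedMonoid 𝒜]

/-- The multiplication `A_i × A_j → A_n` for `i + j = n`, as a bilinear map. -/
def grMul {i j n : ℤ} (h : i + j = n) : 𝒜 i →ₗ[k] 𝒜 j →ₗ[k] 𝒜 n :=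
  LinearMap.mk₂ k (fun a b => ⟨(a : A) * b, h ▸ SetLike.GradedMul.mul_mem a.2 b.2⟩)
    (fun _ _ _ => Subtype.ext (add_mul _ _ _))
    (fun _ _ _ => Subtype.ext (smul_mul_assoc _ _ _))
    (fun _ _ _ => Subtype.ext (mul_add _ _ _))
    (fun _ _ _ => Subtype.ext (mul_smul_comm _ _ _))

/-- The unit of `A` as an element of `A_0`. -/
def grOne : 𝒜 0 := ⟨1, SetLike.GradedOne.one_mem⟩

@[simp] lemma coe_grMul {i j n : ℤ} (h : i + j = n) (a : 𝒜 i) (b : 𝒜 j) :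
    ((grMul 𝒜 h a b : 𝒜 n) : A) = a * b := rfl

@[simp] lemma coe_grOne : ((grOne 𝒜 : 𝒜 0) : A) = 1 := rfl

/-- The `ℤ`-graded algebra is `ℕ`-graded: `A_i = 0` for `i < 0`. -/
class NatGraded (𝒜 : ℤ → Submodule k A) : Prop where
  eq_bot : ∀ i < 0, 𝒜 i = ⊥

/-- The ground field as a graded algebra concentrated in degree `0`. -/
def ground (k : Type u) [Field k] : ℤ → Submodule k k := fun i => if i = 0 then ⊤ else ⊥

lemma ground_zero (x : k) : x ∈ ground k 0 := by simp [ground]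

instance : SetLike.GradedMonoid (ground k) where
  one_mem := ground_zero _
  mul_mem := by
    intro i j a b ha hb
    by_cases hi : i = 0
    · by_cases hj : j = 0
      · subst hi hj; exact ground_zero _
      · have : b = 0 := by simpa [ground, hj] using hb
        simp [this]
    · have : a = 0 := by simpa [ground, hi] using ha
      simp [this]

end Grading

variable {k : Type u} [Field k] {A B C : Type u} [Ring A] [Algebra k A] [Ring B] [Algebra k B]
  [Ring C] [Algebra k C]

/-- A graded `C`-`A`-bimodule (with `k` acting centrally), i.e. an object of
`GrMod (Cᵒ ⊗ₖ A)`: a family of `k`-vector spaces `X n`, `n ∈ ℤ`, with left multiplications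
`C_i × X_j → X_{i+j}` and right multiplications `X_i × A_j → X_{i+j}`. -/
structure GrBimod (𝒞 : ℤ → Submodule k C) [SetLike.GradedMonoid 𝒞]
    (𝒜 : ℤ → Submodule k A) [SetLike.GradedMonoid 𝒜] where
  X : ℤ → Type u
  [grp : ∀ n, AddCommGroup (X n)]
  [mod : ∀ n, Module k (X n)]
  lact : ∀ {i j n : ℤ}, i + j = n → (𝒞 i →ₗ[k] X j →ₗ[k] X n)
  ract : ∀ {i j n : ℤ}, i + j = n → (X i →ₗ[k] 𝒜 j →ₗ[k] X n)
  one_lact : ∀ {n : ℤ} (h : 0 + n = n) (x : X n), lact h (grOne 𝒞) x = x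
  mul_lact : ∀ {i j s p t n : ℤ} (hij : i + j = p) (hps : p + s = n) (hjs : j + s = t)
    (hit : i + t = n) (c : 𝒞 i) (c' : 𝒞 j) (x : X s),
    lact hps (grMul 𝒞 hij c c') x = lact hit c (lact hjs c' x)
  ract_one : ∀ {n : ℤ} (h : n + 0 = n) (x : X n), ract h x (grOne 𝒜) = x
  ract_mul : ∀ {s i j p t n : ℤ} (hij : i + j = p) (hsp : s + p = n) (hsi : s + i = t)
    (htj : t + j = n) (x : X s) (a : 𝒜 i) (a' : 𝒜 j),
    ract hsp x (grMul 𝒜 hij a a') = ract htj (ract hsi x a) a'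
  lact_ract : ∀ {i s j p q n : ℤ} (his : i + s = p) (hpj : p + j = n) (hsj : s + j = q)
    (hiq : i + q = n) (c : 𝒞 i) (x : X s) (a : 𝒜 j),
    ract hpj (lact his c x) a = lact hiq c (ract hsj x a)

attribute [instance] GrBimod.grp GrBimod.mod

variable {𝒞 : ℤ → Submodule k C} [SetLike.GradedMonoid 𝒞]
  {ℬ : ℤ → Submodule k B} [SetLike.GradedMonoid ℬ]
  {𝒜 : ℤ → Submodule k A} [SetLike.GradedMonoid 𝒜]

namespace GrBimod

/-- Homomorphisms of graded bimodules preserving degrees. -/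
@[ext]
structure Hom (M N : GrBimod 𝒞 𝒜) where
  app : ∀ n, M.X n →ₗ[k] N.X n
  map_lact : ∀ {i j n : ℤ} (h : i + j = n) (c : 𝒞 i) (x : M.X j),
    app n (M.lact h c x) = N.lact h c (app j x)
  map_ract : ∀ {i j n : ℤ} (h : i + j = n) (x : M.X i) (a : 𝒜 j),
    app n (M.ract h x a) = N.ract h (app i x) a

instance : Category.{u} (GrBimod 𝒞 𝒜) where
  Hom := Hom
  id M := { app := fun _ => LinearMap.id, map_lact := fun _ _ _ => rfl, map_ract := fun _ _ _ => rfl }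
  comp f g :=
    { app := fun n => (g.app n).comp (f.app n)
      map_lact := fun h c x => by simp [f.map_lact, g.map_lact]
      map_ract := fun h c x => by simp [f.map_ract, g.map_ract] }

/-- The degree-`n` part of a morphism. -/
def app {M N : GrBimod 𝒞 𝒜} (f : M ⟶ N) (n : ℤ) : M.X n →ₗ[k] N.X n := Hom.app f n

section

variable {M N P : GrBimod 𝒞 𝒜}

@[simp] lemma app_id (n : ℤ) : app (𝟙 M) n = LinearMap.id := rfl

@[simp] lemma app_comp (f : M ⟶ N) (g : N ⟶ P) (n : ℤ) :
    app (f ≫ g) n = (app g n).comp (app f n) := rfl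

lemma comp_apply (f : M ⟶ N) (g : N ⟶ P) {n : ℤ} (x : M.X n) :
    app (f ≫ g) n x = app g n (app f n x) := rfl

lemma app_lact (f : M ⟶ N) {i j n : ℤ} (h : i + j = n) (c : 𝒞 i) (x : M.X j) :
    app f n (M.lact h c x) = N.lact h c (app f j x) := Hom.map_lact f h c x

lemma app_ract (f : M ⟶ N) {i j n : ℤ} (h : i + j = n) (x : M.X i) (a : 𝒜 j) :
    app f n (M.ract h x a) = N.ract h (app f i x) a := Hom.map_ract f h x a

lemma hom_ext {f g : M ⟶ N} (h : ∀ n x, app f n x = app g n x) : f = g :=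
  Hom.ext (funext fun n => LinearMap.ext (h n))

lemma app_injective : Function.Injective (fun (f : M ⟶ N) => app f) := fun _ _ h => Hom.ext h

instance : Zero (M ⟶ N) :=
  ⟨{ app := fun _ => 0, map_lact := fun _ _ _ => by simp, map_ract := fun _ _ _ => by simp }⟩

instance : Add (M ⟶ N) :=
  ⟨fun f g =>
    { app := fun n => app f n + app g n
      map_lact := fun _ _ _ => by simp [app_lact]
      map_ract := fun _ _ _ => by simp [app_ract] }⟩

instance : Neg (M ⟶ N) :=
  ⟨fun f =>
    { app := fun n => - app f n
      map_lact := fun _ _ _ => by simp [app_lact]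
      map_ract := fun _ _ _ => by simp [app_ract] }⟩

instance : Sub (M ⟶ N) :=
  ⟨fun f g =>
    { app := fun n => app f n - app g n
      map_lact := fun _ _ _ => by simp [app_lact]
      map_ract := fun _ _ _ => by simp [app_ract] }⟩

instance : SMul ℕ (M ⟶ N) :=
  ⟨fun m f =>
    { app := fun n => m • app f n
      map_lact := fun _ _ _ => by simp [app_lact]
      map_ract := fun _ _ _ => by simp [app_ract] }⟩

instance : SMul ℤ (M ⟶ N) :=
  ⟨fun m f =>
    { app := fun n => m • app f n
      map_lact := fun _ _ _ => by simp [app_lact]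
      map_ract := fun _ _ _ => by simp [app_ract] }⟩

instance : AddCommGroup (M ⟶ N) :=
  Function.Injective.addCommGroup (fun f : M ⟶ N => app f) app_injective
    rfl (fun _ _ => rfl) (fun _ => rfl) (fun _ _ => rfl) (fun _ _ => rfl) (fun _ _ => rfl)

@[simp] lemma app_zero (n : ℤ) : app (0 : M ⟶ N) n = 0 := rfl
@[simp] lemma app_add (f g : M ⟶ N) (n : ℤ) : app (f + g) n = app f n + app g n := rfl

end

instance : Preadditive (GrBimod 𝒞 𝒜) where
  add_comp _ _ _ _ _ _ := hom_ext fun _ _ => by simp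
  comp_add _ _ _ _ _ _ := hom_ext fun _ _ => by simp

/-- Graded sub-bimodules. -/
structure Sub (M : GrBimod 𝒞 𝒜) where
  carrier : ∀ n, Submodule k (M.X n)
  lact_mem : ∀ {i j n : ℤ} (h : i + j = n) (c : 𝒞 i) {x : M.X j}, x ∈ carrier j →
    M.lact h c x ∈ carrier n
  ract_mem : ∀ {i j n : ℤ} (h : i + j = n) {x : M.X i} (a : 𝒜 j), x ∈ carrier i →
    M.ract h x a ∈ carrier n

namespace Sub

variable {M : GrBimod 𝒞 𝒜} (P : Sub M)

/-- A graded sub-bimodule as a graded bimodule. -/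
def toBimod : GrBimod 𝒞 𝒜 where
  X n := P.carrier n
  lact {i j n} h := LinearMap.mk₂ k (fun c x => ⟨M.lact h c x, P.lact_mem h c x.2⟩)
    (fun _ _ _ => Subtype.ext (by simp)) (fun _ _ _ => Subtype.ext (by simp))
    (fun _ _ _ => Subtype.ext (by simp)) (fun _ _ _ => Subtype.ext (by simp))
  ract {i j n} h := LinearMap.mk₂ k (fun x a => ⟨M.ract h x a, P.ract_mem h a x.2⟩)
    (fun _ _ _ => Subtype.ext (by simp)) (fun _ _ _ => Subtype.ext (by simp))
    (fun _ _ _ => Subtype.ext (by simp)) (fun _ _ _ => Subtype.ext (by simp))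
  one_lact h x := Subtype.ext (M.one_lact h x)
  mul_lact h₁ h₂ h₃ h₄ c c' x := Subtype.ext (M.mul_lact h₁ h₂ h₃ h₄ c c' x)
  ract_one h x := Subtype.ext (M.ract_one h x)
  ract_mul h₁ h₂ h₃ h₄ x a a' := Subtype.ext (M.ract_mul h₁ h₂ h₃ h₄ x a a')
  lact_ract h₁ h₂ h₃ h₄ c x a := Subtype.ext (M.lact_ract h₁ h₂ h₃ h₄ c x a)

/-- The inclusion of a graded sub-bimodule. -/
def ι : P.toBimod ⟶ M :=
  { app := fun n => (P.carrier n).subtype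
    map_lact := fun _ _ _ => rfl
    map_ract := fun _ _ _ => rfl : Hom _ _ }

lemma ι_apply {n : ℤ} (x : P.carrier n) : app P.ι n x = (x : M.X n) := rfl

/-- Corestriction of a morphism to a graded sub-bimodule. -/
def lift {N : GrBimod 𝒞 𝒜} (f : N ⟶ M) (hf : ∀ n x, app f n x ∈ P.carrier n) :
    N ⟶ P.toBimod :=
  { app := fun n => (app f n).codRestrict (P.carrier n) (hf n)
    map_lact := fun h c x => Subtype.ext (app_lact f h c x)
    map_ract := fun h x a => Subtype.ext (app_ract f h x a) : Hom _ _ }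

@[simp] lemma lift_ι {N : GrBimod 𝒞 𝒜} (f : N ⟶ M) (hf : ∀ n x, app f n x ∈ P.carrier n) :
    P.lift f hf ≫ P.ι = f := rfl

/-- The quotient of a graded bimodule by a graded sub-bimodule. -/
def quot : GrBimod 𝒞 𝒜 where
  X n := M.X n ⧸ P.carrier n
  lact {i j n} h := LinearMap.mk₂ k
    (fun c => (P.carrier j).mapQ (P.carrier n) (M.lact h c) (fun _ hx => P.lact_mem h c hx))
    (fun _ _ x => by induction x using Submodule.Quotient.induction_on; simp)
    (fun _ _ x => by induction x using Submodule.Quotient.induction_on; simp)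
    (fun _ _ _ => by simp) (fun _ _ _ => by simp)
  ract {i j n} h := LinearMap.flip (LinearMap.mk₂ k
    (fun a => (P.carrier i).mapQ (P.carrier n) ((M.ract h).flip a)
      (fun _ hx => P.ract_mem h a hx))
    (fun a a' x => by
      induction x using Submodule.Quotient.induction_on with | H x =>
      exact congrArg Submodule.Quotient.mk ((M.ract h x).map_add a a'))
    (fun r a x => by
      induction x using Submodule.Quotient.induction_on with | H x =>
      exact congrArg Submodule.Quotient.mk ((M.ract h x).map_smul r a))
    (fun _ _ _ => map_add _ _ _) (fun _ _ _ => map_smul _ _ _))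
  one_lact h x := by
    induction x using Submodule.Quotient.induction_on with | H x =>
    exact congrArg Submodule.Quotient.mk (M.one_lact h x)
  mul_lact h₁ h₂ h₃ h₄ c c' x := by
    induction x using Submodule.Quotient.induction_on with | H x =>
    exact congrArg Submodule.Quotient.mk (M.mul_lact h₁ h₂ h₃ h₄ c c' x)
  ract_one h x := by
    induction x using Submodule.Quotient.induction_on with | H x =>
    exact congrArg Submodule.Quotient.mk (M.ract_one h x)
  ract_mul h₁ h₂ h₃ h₄ x a a' := by
    induction x using Submodule.Quotient.induction_on with | H x =>
    exact congrArg Submodule.Quotient.mk (M.ract_mul h₁ h₂ h₃ h₄ x a a')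
  lact_ract h₁ h₂ h₃ h₄ c x a := by
    induction x using Submodule.Quotient.induction_on with | H x =>
    exact congrArg Submodule.Quotient.mk (M.lact_ract h₁ h₂ h₃ h₄ c x a)

/-- The projection onto the quotient. -/
def π : M ⟶ P.quot :=
  { app := fun n => (P.carrier n).mkQ
    map_lact := fun _ _ _ => rfl
    map_ract := fun _ _ _ => rfl : Hom _ _ }

lemma π_eq_zero_iff {n : ℤ} (x : M.X n) : app P.π n x = 0 ↔ x ∈ P.carrier n :=
  Submodule.Quotient.mk_eq_zero _

lemma π_surjective (n : ℤ) : Function.Surjective (app P.π n) := Submodule.mkQ_surjective _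

/-- The morphism induced on the quotient. -/
def desc {N : GrBimod 𝒞 𝒜} (f : M ⟶ N) (hf : ∀ n, ∀ x ∈ P.carrier n, app f n x = 0) :
    P.quot ⟶ N :=
  { app := fun n => (P.carrier n).liftQ (app f n) (hf n)
    map_lact := fun h c x => by
      induction x using Submodule.Quotient.induction_on; exact app_lact f h c _
    map_ract := fun h x a => by
      induction x using Submodule.Quotient.induction_on; exact app_ract f h _ a : Hom _ _ }

@[simp] lemma π_desc {N : GrBimod 𝒞 𝒜} (f : M ⟶ N)
    (hf : ∀ n, ∀ x ∈ P.carrier n, app f n x = 0) : P.π ≫ P.desc f hf = f := rfl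

end Sub

section Abelian

variable {M N : GrBimod 𝒞 𝒜} (f : M ⟶ N)

/-- The kernel of a morphism, as a graded sub-bimodule. -/
def ker : Sub M where
  carrier n := LinearMap.ker (app f n)
  lact_mem h c x hx := by
    rw [LinearMap.mem_ker] at hx ⊢; rw [app_lact, hx, map_zero]
  ract_mem h x a hx := by
    rw [LinearMap.mem_ker] at hx ⊢; rw [app_ract, hx, map_zero, LinearMap.zero_apply]

/-- The image of a morphism, as a graded sub-bimodule. -/
def range : Sub N where
  carrier n := LinearMap.range (app f n)
  lact_mem := by
    rintro i j n h c _ ⟨y, rfl⟩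
    exact ⟨M.lact h c y, app_lact f h c y⟩
  ract_mem := by
    rintro i j n h _ a ⟨y, rfl⟩
    exact ⟨M.ract h y a, app_ract f h y a⟩

lemma ker_ι_comp : (ker f).ι ≫ f = 0 := hom_ext fun _ x => x.2

lemma comp_range_π : f ≫ (range f).π = 0 :=
  hom_ext fun _ x => ((range f).π_eq_zero_iff _).2 ⟨x, rfl⟩

instance (P : Sub M) : Mono P.ι where
  right_cancellation _ _ e := hom_ext fun n x =>
    Subtype.ext (congrArg (fun t => app t n x) e)

instance (P : Sub M) : Epi P.π where
  left_cancellation _ _ e := hom_ext fun n x => by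
    obtain ⟨y, rfl⟩ := P.π_surjective n x
    exact congrArg (fun t => app t n y) e

lemma injective_of_mono [Mono f] (n : ℤ) : Function.Injective (app f n) := by
  rw [injective_iff_map_eq_zero]
  intro x hx
  have h0 : (ker f).ι = 0 := by
    rw [← cancel_mono f, ker_ι_comp, zero_comp]
  have := congrArg (fun t => app t n (⟨x, hx⟩ : (ker f).carrier n)) h0
  exact this

lemma surjective_of_epi [Epi f] (n : ℤ) : Function.Surjective (app f n) := by
  intro y
  have h0 : (range f).π = 0 := by
    rw [← cancel_epi f, comp_range_π, comp_zero]
  have := congrArg (fun t => app t n y) h0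
  exact ((range f).π_eq_zero_iff y).1 this

lemma mono_of_injective (h : ∀ n, Function.Injective (app f n)) : Mono f where
  right_cancellation _ _ e := hom_ext fun n x => h n (congrArg (fun t => app t n x) e)

lemma epi_of_surjective (h : ∀ n, Function.Surjective (app f n)) : Epi f where
  left_cancellation _ _ e := hom_ext fun n x => by
    obtain ⟨y, rfl⟩ := h n x
    exact congrArg (fun t => app t n y) e

instance : HasKernels (GrBimod 𝒞 𝒜) where
  has_limit f := ⟨⟨⟨KernelFork.ofι (ker f).ι (ker_ι_comp f),
    KernelFork.IsLimit.ofι' _ _ fun g hg =>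
      ⟨(ker f).lift g (fun n x => congrArg (fun t => app t n x) hg), rfl⟩⟩⟩⟩

instance : HasCokernels (GrBimod 𝒞 𝒜) where
  has_colimit f := ⟨⟨⟨CokernelCofork.ofπ (range f).π (comp_range_π f),
    CokernelCofork.IsColimit.ofπ' _ _ fun g hg =>
      ⟨(range f).desc g (by rintro n _ ⟨x, rfl⟩; exact congrArg (fun t => app t n x) hg),
        rfl⟩⟩⟩⟩

/-- A morphism into the image of an injective morphism factors through it. -/
def liftInj (hf : ∀ n, Function.Injective (app f n)) {P : GrBimod 𝒞 𝒜} (g : P ⟶ N)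
    (hg : ∀ n x, app g n x ∈ LinearMap.range (app f n)) : P ⟶ M :=
  { app := fun n => (LinearEquiv.ofInjective (app f n) (hf n)).symm.toLinearMap.comp
      ((app g n).codRestrict _ (hg n))
    map_lact := fun h c x => by
      apply hf
      have key : ∀ n x, app f n ((LinearEquiv.ofInjective (app f n) (hf n)).symm
          ((app g n).codRestrict _ (hg n) x)) = app g n x := fun n x =>
        congrArg Subtype.val ((LinearEquiv.ofInjective (app f n) (hf n)).apply_symm_apply _)
      simp only [LinearMap.comp_apply, LinearEquiv.coe_coe, key, app_lact]
    map_ract := fun {i j n} h x a => by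
      apply hf
      have key : ∀ n x, app f n ((LinearEquiv.ofInjective (app f n) (hf n)).symm
          ((app g n).codRestrict _ (hg n) x)) = app g n x := fun n x =>
        congrArg Subtype.val ((LinearEquiv.ofInjective (app f n) (hf n)).apply_symm_apply _)
      simp only [LinearMap.comp_apply, LinearEquiv.coe_coe, key, app_ract] : Hom _ _ }

lemma liftInj_comp (hf : ∀ n, Function.Injective (app f n)) {P : GrBimod 𝒞 𝒜} (g : P ⟶ N)
    (hg : ∀ n x, app g n x ∈ LinearMap.range (app f n)) : liftInj f hf g hg ≫ f = g :=
  hom_ext fun n _ =>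
    congrArg Subtype.val ((LinearEquiv.ofInjective (app f n) (hf n)).apply_symm_apply _)

/-- A morphism vanishing on the kernel of a surjective morphism factors through it. -/
def descSurj (hf : ∀ n, Function.Surjective (app f n)) {P : GrBimod 𝒞 𝒜} (g : M ⟶ P)
    (hg : ∀ n x, app f n x = 0 → app g n x = 0) : N ⟶ P :=
  have key : ∀ n x, ((LinearMap.ker (app f n)).liftQ (app g n) (hg n))
      (((app f n).quotKerEquivOfSurjective (hf n)).symm (app f n x)) = app g n x := fun n x => by
    rw [show app f n x = (app f n).quotKerEquivOfSurjective (hf n)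
      (Submodule.Quotient.mk x) from rfl, LinearEquiv.symm_apply_apply]; rfl
  { app := fun n => ((LinearMap.ker (app f n)).liftQ (app g n) (hg n)).comp
      ((app f n).quotKerEquivOfSurjective (hf n)).symm.toLinearMap
    map_lact := fun {i j n} h c x => by
      obtain ⟨y, rfl⟩ := hf _ x
      simp only [LinearMap.comp_apply, LinearEquiv.coe_coe, ← app_lact, key]
    map_ract := fun {i j n} h x a => by
      obtain ⟨y, rfl⟩ := hf _ x
      simp only [LinearMap.comp_apply, LinearEquiv.coe_coe, ← app_ract, key] : Hom _ _ }

lemma comp_descSurj (hf : ∀ n, Function.Surjective (app f n)) {P : GrBimod 𝒞 𝒜} (g : M ⟶ P)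
    (hg : ∀ n x, app f n x = 0 → app g n x = 0) : f ≫ descSurj f hf g hg = g :=
  hom_ext fun n x => by
    change ((LinearMap.ker (app f n)).liftQ (app g n) (hg n))
      (((app f n).quotKerEquivOfSurjective (hf n)).symm (app f n x)) = app g n x
    rw [show app f n x = (app f n).quotKerEquivOfSurjective (hf n)
      (Submodule.Quotient.mk x) from rfl, LinearEquiv.symm_apply_apply]; rfl

/-- Products of graded bimodules. -/
def pi {J : Type} (M : J → GrBimod 𝒞 𝒜) : GrBimod 𝒞 𝒜 where
  X n := ∀ j, (M j).X n
  lact h := LinearMap.mk₂ k (fun c x j => (M j).lact h c (x j))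
    (fun _ _ _ => funext fun _ => by simp) (fun _ _ _ => funext fun _ => by simp)
    (fun _ _ _ => funext fun _ => by simp) (fun _ _ _ => funext fun _ => by simp)
  ract h := LinearMap.mk₂ k (fun x a j => (M j).ract h (x j) a)
    (fun _ _ _ => funext fun _ => by simp) (fun _ _ _ => funext fun _ => by simp)
    (fun _ _ _ => funext fun _ => by simp) (fun _ _ _ => funext fun _ => by simp)
  one_lact h x := funext fun j => (M j).one_lact h (x j)
  mul_lact h₁ h₂ h₃ h₄ c c' x := funext fun j => (M j).mul_lact h₁ h₂ h₃ h₄ c c' (x j)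
  ract_one h x := funext fun j => (M j).ract_one h (x j)
  ract_mul h₁ h₂ h₃ h₄ x a a' := funext fun j => (M j).ract_mul h₁ h₂ h₃ h₄ (x j) a a'
  lact_ract h₁ h₂ h₃ h₄ c x a := funext fun j => (M j).lact_ract h₁ h₂ h₃ h₄ c (x j) a

/-- The projections of a product of graded bimodules. -/
def piProj {J : Type} (M : J → GrBimod 𝒞 𝒜) (j : J) : pi M ⟶ M j :=
  { app := fun _ => LinearMap.proj j
    map_lact := fun _ _ _ => rfl
    map_ract := fun _ _ _ => rfl : Hom _ _ }

instance : HasProducts.{0} (GrBimod 𝒞 𝒜) :=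
  hasProducts_of_limit_fans (fun M => Fan.mk (pi M) (piProj M)) (fun _ =>
    Fan.IsLimit.mk _
      (fun s =>
        { app := fun n => LinearMap.pi fun j => app (s.proj j) n
          map_lact := fun h c x => funext fun j => app_lact (s.proj j) h c x
          map_ract := fun h x a => funext fun j => app_ract (s.proj j) h x a : Hom _ _ })
      (fun _ _ => rfl)
      (fun _ _ hm => hom_ext fun n x => funext fun j =>
        congrArg (fun t => app t n x) (hm j)))

instance : Abelian (GrBimod 𝒞 𝒜) where
  has_finite_products := hasFiniteProducts_of_hasProducts _
  normalMonoOfMono f _ := ⟨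
    { Z := (range f).quot
      g := (range f).π
      w := comp_range_π f
      isLimit := KernelFork.IsLimit.ofι' _ _ fun g hg =>
        ⟨liftInj f (injective_of_mono f) g
          (fun n x => ((range f).π_eq_zero_iff _).1 (congrArg (fun t => app t n x) hg)),
          liftInj_comp _ _ _ _⟩ }⟩
  normalEpiOfEpi f _ := ⟨
    { W := (ker f).toBimod
      g := (ker f).ι
      w := ker_ι_comp f
      isColimit := CokernelCofork.IsColimit.ofπ' _ _ fun g hg =>
        ⟨descSurj f (surjective_of_epi f) g
          (fun n x hx => congrArg (fun t => app t n (⟨x, hx⟩ : (ker f).carrier n)) hg),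
          comp_descSurj _ _ _ _⟩ }⟩

/-- Exactness of graded bimodules is exactness in each degree. -/
lemma exact_iff (S : ShortComplex (GrBimod 𝒞 𝒜)) :
    S.Exact ↔ ∀ n x, app S.g n x = 0 → ∃ y, app S.f n y = x := by
  rw [S.exact_iff_epi_kernel_lift]
  have hk : ∀ n y, app (kernel.ι S.g) n (app (kernel.lift S.g S.f S.zero) n y) = app S.f n y :=
    fun n y => congrArg (fun t => app t n y) (kernel.lift_ι S.g S.f S.zero)
  constructor
  · intro h n x hx
    let z : (ker S.g).toBimod ⟶ kernel S.g := kernel.lift S.g _ (ker_ι_comp S.g)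
    obtain ⟨y, hy⟩ := surjective_of_epi (kernel.lift S.g S.f S.zero) n
      (app z n (⟨x, hx⟩ : (ker S.g).carrier n))
    refine ⟨y, ?_⟩
    rw [← hk, hy]
    exact congrArg (fun t => app t n (⟨x, hx⟩ : (ker S.g).carrier n))
      (kernel.lift_ι S.g _ (ker_ι_comp S.g))
  · intro h
    refine epi_of_surjective _ fun n x => ?_
    obtain ⟨y, hy⟩ := h n (app (kernel.ι S.g) n x)
      (congrArg (fun t => app t n x) (kernel.condition S.g))
    exact ⟨y, injective_of_mono (kernel.ι S.g) n ((hk n y).trans hy)⟩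

end Abelian


/-! ### Enough injectives -/

section EnoughInjectives

variable (𝒞 𝒜) in
/-- The bimodule coinduced from a graded vector space `V`: its degree-`n` part consists of the
families of bilinear maps `C_i × A_j → V_{i+n+j}`. -/
def cofree (V : ℤ → Type u) [∀ n, AddCommGroup (V n)] [∀ n, Module k (V n)] : GrBimod 𝒞 𝒜 where
  X n := ({ carrier := {f | ∀ i j m, i + n + j ≠ m → f i j m = 0}
            add_mem' := fun hf hg i j m h => by simp [hf i j m h, hg i j m h]
            zero_mem' := fun _ _ _ _ => rfl
            smul_mem' := fun r f hf i j m h => by simp [hf i j m h] } :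
          Submodule k (∀ i j m : ℤ, 𝒞 i →ₗ[k] 𝒜 j →ₗ[k] V m))
  lact {i s n} h := LinearMap.mk₂ k
    (fun c f => ⟨fun i' j m => (f.1 (i' + i) j m).comp ((grMul 𝒞 rfl).flip c),
      fun i' j m hm => by
        change (f.1 (i' + i) j m).comp _ = 0
        rw [f.2 _ _ _ (by omega)]; rfl⟩)
    (fun _ _ _ => Subtype.ext (by ext; simp)) (fun _ _ _ => Subtype.ext (by ext; simp))
    (fun _ _ _ => Subtype.ext (by ext; simp)) (fun _ _ _ => Subtype.ext (by ext; simp))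
  ract {s j n} h := LinearMap.mk₂ k
    (fun f a => ⟨fun i j' m => (f.1 i (j + j') m).compl₂ (grMul 𝒜 rfl a),
      fun i j' m hm => by
        change (f.1 i (j + j') m).compl₂ _ = 0
        rw [f.2 _ _ _ (by omega)]; rfl⟩)
    (fun _ _ _ => Subtype.ext (by ext; simp)) (fun _ _ _ => Subtype.ext (by ext; simp))
    (fun _ _ _ => Subtype.ext (by ext; simp)) (fun _ _ _ => Subtype.ext (by ext; simp))
  one_lact h f := Subtype.ext (by
    ext i j m c a
    have key : ∀ i₁ (_ : i = i₁) (c₁ : 𝒞 i₁), (c : C) = c₁ → f.1 i₁ j m c₁ a = f.1 i j m c a := by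
      rintro _ rfl c₁ e; rw [Subtype.ext e]
    exact key (i + 0) (by omega) _ (by simp))
  mul_lact {i j s p t n} hij hps hjs hit c c' f := Subtype.ext (by
    ext i' j' m d a
    have key : ∀ i₁ i₂ (_ : i₁ = i₂) (c₁ : 𝒞 i₁) (c₂ : 𝒞 i₂), (c₁ : C) = c₂ →
        f.1 i₁ j' m c₁ a = f.1 i₂ j' m c₂ a := by
      rintro _ _ rfl c₁ c₂ e; rw [Subtype.ext e]
    exact key (i' + p) (i' + i + j) (by omega) _ _ (by simp [mul_assoc]))
  ract_one h f := Subtype.ext (by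
    ext i j m c a
    have key : ∀ j₁ (_ : j = j₁) (a₁ : 𝒜 j₁), (a : A) = a₁ → f.1 i j₁ m c a₁ = f.1 i j m c a := by
      rintro _ rfl c₁ e; rw [Subtype.ext e]
    exact key (0 + j) (by omega) _ (by simp))
  ract_mul {s i j p t n} hij hsp hsi htj f a a' := Subtype.ext (by
    ext i' j' m c b
    have key : ∀ j₁ j₂ (_ : j₁ = j₂) (a₁ : 𝒜 j₁) (a₂ : 𝒜 j₂), (a₁ : A) = a₂ →
        f.1 i' j₁ m c a₁ = f.1 i' j₂ m c a₂ := by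
      rintro _ _ rfl c₁ c₂ e; rw [Subtype.ext e]
    exact key (p + j') (i + (j + j')) (by omega) _ _ (by simp [mul_assoc]))
  lact_ract _ _ _ _ _ _ _ := rfl

variable {V : ℤ → Type u} [∀ n, AddCommGroup (V n)] [∀ n, Module k (V n)]

/-- Evaluation of the coinduced bimodule at `1`. -/
def cofreeEval (n : ℤ) : (cofree 𝒞 𝒜 V).X n →ₗ[k] V n where
  toFun f := f.1 0 0 n (grOne 𝒞) (grOne 𝒜)
  map_add' _ _ := rfl
  map_smul' _ _ := rfl

lemma cofreeEval_act {s i j p q : ℤ} (f : (cofree 𝒞 𝒜 V).X s) (h : i + s = p) (h' : p + j = q)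
    (c : 𝒞 i) (a : 𝒜 j) :
    cofreeEval q ((cofree 𝒞 𝒜 V).ract h' ((cofree 𝒞 𝒜 V).lact h c f) a) = f.1 i j q c a := by
  have key : ∀ i₁ (_ : i = i₁) (c₁ : 𝒞 i₁) j₁ (_ : j = j₁) (a₁ : 𝒜 j₁), (c : C) = c₁ →
      (a : A) = a₁ → f.1 i₁ j₁ q c₁ a₁ = f.1 i j q c a := by
    rintro _ rfl c₁ _ rfl a₁ e e'; rw [Subtype.ext e, Subtype.ext e']
  exact key (0 + i) (by omega) _ (j + 0) (by omega) _ (by simp) (by simp)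

lemma cofree_hom_ext {M : GrBimod 𝒞 𝒜} {f g : M ⟶ cofree 𝒞 𝒜 V}
    (h : ∀ n x, cofreeEval n (app f n x) = cofreeEval n (app g n x)) : f = g :=
  hom_ext fun n x => Subtype.ext (by
    ext i j m c a
    by_cases hm : i + n + j = m
    · rw [← cofreeEval_act (app f n x) rfl hm c a, ← cofreeEval_act (app g n x) rfl hm c a,
        ← app_lact, ← app_lact, ← app_ract, ← app_ract, h]
    · rw [(app f n x).2 _ _ _ hm, (app g n x).2 _ _ _ hm])

lemma act_index (M : GrBimod 𝒞 𝒜) {i n j m p p' : ℤ} (h₁ : i + n = p) (h₂ : p + j = m)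
    (h₁' : i + n = p') (h₂' : p' + j = m) (c : 𝒞 i) (x : M.X n) (a : 𝒜 j) :
    M.ract h₂ (M.lact h₁ c x) a = M.ract h₂' (M.lact h₁' c x) a := by
  subst h₁; subst h₁'; rfl

/-- The trilinear map `(x, c, a) ↦ φ (c x a)`. -/
def cofreeLiftAux {M : GrBimod 𝒞 𝒜} (φ : ∀ n, M.X n →ₗ[k] V n) {n : ℤ} (x : M.X n)
    (i j m : ℤ) : 𝒞 i →ₗ[k] 𝒜 j →ₗ[k] V m :=
  if h : i + n + j = m then
    LinearMap.mk₂ k (fun c a => φ m (M.ract h (M.lact rfl c x) a))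
      (fun _ _ _ => by simp) (fun _ _ _ => by simp) (fun _ _ _ => by simp)
      (fun _ _ _ => by simp)
  else 0

lemma cofreeLiftAux_apply {M : GrBimod 𝒞 𝒜} (φ : ∀ n, M.X n →ₗ[k] V n) {n : ℤ} (x : M.X n)
    {i j m p : ℤ} (h₁ : i + n = p) (h₂ : p + j = m) (c : 𝒞 i) (a : 𝒜 j) :
    cofreeLiftAux φ x i j m c a = φ m (M.ract h₂ (M.lact h₁ c x) a) := by
  subst h₁
  rw [cofreeLiftAux, dif_pos h₂]; rfl

lemma cofreeLiftAux_of_ne {M : GrBimod 𝒞 𝒜} (φ : ∀ n, M.X n →ₗ[k] V n) {n : ℤ} (x : M.X n)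
    {i j m : ℤ} (h : i + n + j ≠ m) : cofreeLiftAux φ x i j m = 0 := dif_neg h

/-- The morphism to a coinduced bimodule given by linear maps in each degree. -/
def cofreeLift {M : GrBimod 𝒞 𝒜} (φ : ∀ n, M.X n →ₗ[k] V n) : M ⟶ cofree 𝒞 𝒜 V :=
  { app := fun n =>
      { toFun := fun x => (⟨cofreeLiftAux φ x, fun _ _ _ h => cofreeLiftAux_of_ne φ x h⟩ :
          Subtype _)
        map_add' := fun x y => Subtype.ext (by
          ext i j m c a
          change cofreeLiftAux φ (x + y) i j m c a =
            cofreeLiftAux φ x i j m c a + cofreeLiftAux φ y i j m c a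
          by_cases h : i + n + j = m
          · simp [cofreeLiftAux_apply φ _ rfl h]
          · simp [cofreeLiftAux_of_ne φ _ h])
        map_smul' := fun r x => Subtype.ext (by
          ext i j m c a
          change cofreeLiftAux φ (r • x) i j m c a = r • cofreeLiftAux φ x i j m c a
          by_cases h : i + n + j = m
          · simp [cofreeLiftAux_apply φ _ rfl h]
          · simp [cofreeLiftAux_of_ne φ _ h]) }
    map_lact := fun {i s n} h c x => Subtype.ext (by
      ext i' j m c' a
      change cofreeLiftAux φ (M.lact h c x) i' j m c' a =
        cofreeLiftAux φ x (i' + i) j m (grMul 𝒞 rfl c' c) a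
      by_cases hm : i' + n + j = m
      · rw [cofreeLiftAux_apply φ _ rfl hm,
          cofreeLiftAux_apply φ _ (show i' + i + s = i' + n by omega) hm,
          M.mul_lact rfl _ h rfl]
      · rw [cofreeLiftAux_of_ne φ _ hm, cofreeLiftAux_of_ne φ _ (by omega)]; rfl)
    map_ract := fun {s j n} h x a => Subtype.ext (by
      ext i j' m c a'
      change cofreeLiftAux φ (M.ract h x a) i j' m c a' =
        cofreeLiftAux φ x i (j + j') m c (grMul 𝒜 rfl a a')
      by_cases hm : i + n + j' = m
      · rw [cofreeLiftAux_apply φ _ rfl hm,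
          cofreeLiftAux_apply φ _ (rfl : i + s = i + s) (by omega),
          M.ract_mul rfl _ (show i + s + j = i + n by omega) hm, M.lact_ract rfl _ h rfl]
      · rw [cofreeLiftAux_of_ne φ _ hm, cofreeLiftAux_of_ne φ _ (by omega)]; rfl) : Hom _ _ }

lemma cofreeEval_lift {M : GrBimod 𝒞 𝒜} (φ : ∀ n, M.X n →ₗ[k] V n) {n : ℤ} (x : M.X n) :
    cofreeEval n (app (cofreeLift φ) n x) = φ n x := by
  change cofreeLiftAux φ x 0 0 n (grOne 𝒞) (grOne 𝒜) = φ n x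
  rw [cofreeLiftAux_apply φ x (zero_add n) (add_zero n), M.one_lact, M.ract_one]

instance : Injective (cofree 𝒞 𝒜 V) where
  factors {M N} g f _ := by
    have hex : ∀ n, ∃ φ : N.X n →ₗ[k] V n,
        φ.comp (app f n) = (cofreeEval n).comp (app g n) := fun n => by
      obtain ⟨r, hr⟩ := (app f n).exists_leftInverse_of_injective
        (LinearMap.ker_eq_bot.2 (injective_of_mono f n))
      exact ⟨((cofreeEval n).comp (app g n)).comp r, by
        rw [LinearMap.comp_assoc, hr, LinearMap.comp_id]⟩
    choose φ hφ using hex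
    exact ⟨cofreeLift φ, cofree_hom_ext fun n x => by
      rw [comp_apply, cofreeEval_lift]; exact LinearMap.congr_fun (hφ n) x⟩

instance : EnoughInjectives (GrBimod 𝒞 𝒜) where
  presentation M := ⟨
    { J := cofree 𝒞 𝒜 M.X
      f := cofreeLift fun _ => LinearMap.id
      mono := mono_of_injective _ fun n x y h => by
        rw [← LinearMap.id_apply (R := k) x, ← LinearMap.id_apply (R := k) y,
          ← cofreeEval_lift (fun n => (LinearMap.id : M.X n →ₗ[k] M.X n)), h, cofreeEval_lift] }⟩

end EnoughInjectives

/-! ### Basic constructions -/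

/-- The shift `M(ℓ)`, with `M(ℓ)_n = M_{ℓ+n}`. -/
def shift (M : GrBimod 𝒞 𝒜) (ℓ : ℤ) : GrBimod 𝒞 𝒜 where
  X n := M.X (ℓ + n)
  lact h := M.lact (by omega)
  ract h := M.ract (by omega)
  one_lact _ x := M.one_lact _ x
  mul_lact h₁ _ _ _ c c' x := M.mul_lact h₁ _ _ _ c c' x
  ract_one _ x := M.ract_one _ x
  ract_mul h₁ _ _ _ x a a' := M.ract_mul h₁ _ _ _ x a a'
  lact_ract _ _ _ _ c x a := M.lact_ract _ _ _ _ c x a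

/-- The graded dual `DM`, with `(DM)_n = Hom_k(M_{-n}, k)`; for a `C`-`A`-bimodule `M` it is an
`A`-`C`-bimodule through `(a φ)(x) = φ(x a)` and `(φ c)(x) = φ(c x)`. -/
def dual (M : GrBimod 𝒞 𝒜) : GrBimod 𝒜 𝒞 where
  X n := M.X (-n) →ₗ[k] k
  lact {i j n} h := LinearMap.mk₂ k
    (fun a φ => φ.comp ((M.ract (show -n + i = -j by omega)).flip a))
    (fun _ _ _ => by ext; simp) (fun _ _ _ => by ext; simp)
    (fun _ _ _ => by ext; simp) (fun _ _ _ => by ext; simp)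
  ract {i j n} h := LinearMap.mk₂ k
    (fun φ c => φ.comp (M.lact (show j + -n = -i by omega) c))
    (fun _ _ _ => by ext; simp) (fun _ _ _ => by ext; simp)
    (fun _ _ _ => by ext; simp) (fun _ _ _ => by ext; simp)
  one_lact {n} h φ := LinearMap.ext fun x => congrArg φ (M.ract_one _ x)
  mul_lact {i j s p t n} hij _ _ _ a a' φ := LinearMap.ext fun x =>
    congrArg φ (M.ract_mul hij (by omega) (by omega) (by omega) x a a')
  ract_one {n} h φ := LinearMap.ext fun x => congrArg φ (M.one_lact _ x)
  ract_mul {s i j p t n} hij _ _ _ φ c c' := LinearMap.ext fun x =>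
    congrArg φ (M.mul_lact hij (by omega) (by omega) (by omega) c c' x)
  lact_ract {i s j p q n} _ _ _ _ a φ c := LinearMap.ext fun x =>
    congrArg φ
    (M.lact_ract (show j + -n = -p by omega) (show -p + i = -s by omega)
      (show -n + i = -q by omega) (show j + -q = -s by omega) c x a)

variable (𝒜) in
/-- The algebra `A` as a graded `A`-`A`-bimodule. -/
def self : GrBimod 𝒜 𝒜 where
  X n := 𝒜 n
  lact h := grMul 𝒜 h
  ract h := grMul 𝒜 h
  one_lact _ _ := Subtype.ext (one_mul _)
  mul_lact _ _ _ _ _ _ _ := Subtype.ext (mul_assoc _ _ _)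
  ract_one _ _ := Subtype.ext (mul_one _)
  ract_mul _ _ _ _ _ _ _ := Subtype.ext (mul_assoc _ _ _).symm
  lact_ract _ _ _ _ _ _ _ := Subtype.ext (mul_assoc _ _ _)

variable (𝒜) in
/-- The graded ideal `A_{≥ 1}` of an `ℕ`-graded algebra, as a sub-bimodule of `A`. -/
def augmentation [NatGraded 𝒜] : Sub (self 𝒜) where
  carrier n := if 1 ≤ n then ⊤ else ⊥
  lact_mem {i j n} h c x hx := by
    by_cases hj : 1 ≤ j
    · by_cases hi : i < 0
      · have h0 : c = 0 := Subtype.ext ((Submodule.mem_bot k).1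
          ((NatGraded.eq_bot (𝒜 := 𝒜) i hi).le c.2))
        rw [h0, map_zero, LinearMap.zero_apply]; exact Submodule.zero_mem _
      · rw [if_pos (by omega)]; trivial
    · rw [if_neg hj, Submodule.mem_bot] at hx
      rw [hx, map_zero]; exact Submodule.zero_mem _
  ract_mem {i j n} h x c hx := by
    by_cases hj : 1 ≤ i
    · by_cases hi : j < 0
      · have h0 : c = 0 := Subtype.ext ((Submodule.mem_bot k).1
          ((NatGraded.eq_bot (𝒜 := 𝒜) j hi).le c.2))
        rw [h0, map_zero]; exact Submodule.zero_mem _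
      · rw [if_pos (by omega)]; trivial
    · rw [if_neg hj, Submodule.mem_bot] at hx
      rw [hx, map_zero, LinearMap.zero_apply]; exact Submodule.zero_mem _

variable (𝒜) in
/-- `R = A_0` as a graded `A`-`A`-bimodule concentrated in degree `0`, namely `A / A_{≥ 1}`. -/
def degZero [NatGraded 𝒜] : GrBimod 𝒜 𝒜 := (augmentation 𝒜).quot

/-! ### Restriction to one side -/

variable (𝒜) in
/-- The structure map `k → A` in each degree. -/
def groundMap (i : ℤ) : ground k i →ₗ[k] 𝒜 i where
  toFun r := ⟨algebraMap k A r, by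
    obtain ⟨r, hr⟩ := r
    by_cases hi : i = 0
    · subst hi
      rw [Algebra.algebraMap_eq_smul_one]
      exact Submodule.smul_mem _ _ SetLike.GradedOne.one_mem
    · have : r = 0 := by simpa [ground, hi] using hr
      simp [this]⟩
  map_add' _ _ := Subtype.ext (by simp)
  map_smul' _ _ := Subtype.ext (by simp [Algebra.smul_def])

lemma groundMap_one : groundMap 𝒜 0 (grOne (ground k)) = grOne 𝒜 :=
  Subtype.ext (map_one (algebraMap k A))

lemma groundMap_mul {i j n : ℤ} (h : i + j = n) (r : ground k i) (s : ground k j) :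
    groundMap 𝒜 n (grMul (ground k) h r s) = grMul 𝒜 h (groundMap 𝒜 i r) (groundMap 𝒜 j s) :=
  Subtype.ext (map_mul (algebraMap k A) _ _)

/-- The underlying graded right `A`-module of a graded bimodule. -/
def toRightObj (M : GrBimod 𝒞 𝒜) : GrBimod (ground k) 𝒜 :=
    { X := M.X
      lact := fun {i _ _} h => (M.lact h).comp (groundMap 𝒞 i)
      ract := M.ract
      one_lact := fun h x => by
        rw [LinearMap.comp_apply, groundMap_one, M.one_lact]
      mul_lact := fun h₁ h₂ h₃ h₄ c c' x => by
        simp only [LinearMap.comp_apply, groundMap_mul, M.mul_lact h₁ h₂ h₃ h₄]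
      ract_one := M.ract_one
      ract_mul := M.ract_mul
      lact_ract := fun h₁ h₂ h₃ h₄ c x a => M.lact_ract h₁ h₂ h₃ h₄ _ x a }

variable (𝒞 𝒜) in
/-- The functor `GrMod (Cᵒ ⊗ₖ A) ⥤ GrMod A` forgetting the left action. -/
def toRight : GrBimod 𝒞 𝒜 ⥤ GrBimod (ground k) 𝒜 where
  obj M := M.toRightObj
  map {M N} f :=
    { app := fun n => GrBimod.app (M := M) (N := N) f n
      map_lact := fun h c x => app_lact (M := M) (N := N) f h _ x
      map_ract := app_ract (M := M) (N := N) f : Hom M.toRightObj N.toRightObj }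

/-- The underlying graded left `C`-module of a graded bimodule. -/
def toLeftObj (M : GrBimod 𝒞 𝒜) : GrBimod 𝒞 (ground k) :=
    { X := M.X
      lact := M.lact
      ract := fun {_ j _} h => (M.ract h).compl₂ (groundMap 𝒜 j)
      one_lact := M.one_lact
      mul_lact := M.mul_lact
      ract_one := fun h x => by
        rw [LinearMap.compl₂_apply, groundMap_one, M.ract_one]
      ract_mul := fun h₁ h₂ h₃ h₄ x a a' => by
        simp only [LinearMap.compl₂_apply, groundMap_mul, M.ract_mul h₁ h₂ h₃ h₄]
      lact_ract := fun h₁ h₂ h₃ h₄ c x a => M.lact_ract h₁ h₂ h₃ h₄ c x _ }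

variable (𝒞 𝒜) in
/-- The functor `GrMod (Cᵒ ⊗ₖ A) ⥤ GrMod Cᵒ` forgetting the right action. -/
def toLeft : GrBimod 𝒞 𝒜 ⥤ GrBimod 𝒞 (ground k) where
  obj M := M.toLeftObj
  map {M N} f :=
    { app := fun n => GrBimod.app (M := M) (N := N) f n
      map_lact := app_lact (M := M) (N := N) f
      map_ract := fun h x a => app_ract (M := M) (N := N) f h x _ : Hom M.toLeftObj N.toLeftObj }

instance : (toRight 𝒞 𝒜).Additive where
  map_add := rfl
instance : (toLeft 𝒞 𝒜).Additive where
  map_add := rfl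

lemma toRight_exact :
    PreservesFiniteLimits (toRight 𝒞 𝒜) ∧ PreservesFiniteColimits (toRight 𝒞 𝒜) :=
  ((toRight 𝒞 𝒜).exact_tfae.out 1 3).1 fun (S : ShortComplex (GrBimod 𝒞 𝒜)) hS =>
    (exact_iff (S.map (toRight 𝒞 𝒜))).2 ((exact_iff S).1 hS)

lemma toLeft_exact :
    PreservesFiniteLimits (toLeft 𝒞 𝒜) ∧ PreservesFiniteColimits (toLeft 𝒞 𝒜) :=
  ((toLeft 𝒞 𝒜).exact_tfae.out 1 3).1 fun (S : ShortComplex (GrBimod 𝒞 𝒜)) hS =>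
    (exact_iff (S.map (toLeft 𝒞 𝒜))).2 ((exact_iff S).1 hS)

instance : PreservesFiniteLimits (toRight 𝒞 𝒜) := toRight_exact.1
instance : PreservesFiniteColimits (toRight 𝒞 𝒜) := toRight_exact.2
instance : PreservesFiniteLimits (toLeft 𝒞 𝒜) := toLeft_exact.1
instance : PreservesFiniteColimits (toLeft 𝒞 𝒜) := toLeft_exact.2

/-! ### The torsion functor and the graded Hom functor -/

/-- The sub-bimodule of all `x` with `x A_{≥ N} = 0` for some `N`, that is, the image of
`lim_{N → ∞} Hom_A(A / A_{≥ N}, M)` in `M` under evaluation at `1`. -/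
def torsion (M : GrBimod 𝒞 𝒜) : Sub M where
  carrier n :=
    { carrier := {x | ∃ N : ℤ, ∀ (j m : ℤ) (h : n + j = m) (a : 𝒜 j), N ≤ j → M.ract h x a = 0}
      add_mem' := by
        rintro x y ⟨N, hN⟩ ⟨N', hN'⟩
        refine ⟨max N N', fun j m h a hj => ?_⟩
        rw [map_add, LinearMap.add_apply, hN j m h a (le_trans (le_max_left _ _) hj),
          hN' j m h a (le_trans (le_max_right _ _) hj), add_zero]
      zero_mem' := ⟨0, fun j m h a _ => by simp⟩
      smul_mem' := by
        rintro r x ⟨N, hN⟩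
        exact ⟨N, fun j m h a hj => by rw [map_smul, LinearMap.smul_apply, hN j m h a hj, smul_zero]⟩ }
  lact_mem := by
    rintro i j n h c x ⟨N, hN⟩
    refine ⟨N, fun s m hm a hs => ?_⟩
    rw [M.lact_ract h hm rfl (by omega), hN s _ rfl a hs, map_zero]
  ract_mem := by
    rintro i j n h x a ⟨N, hN⟩
    refine ⟨N - j, fun s m hm a' hs => ?_⟩
    rw [← M.ract_mul rfl (by omega) h hm, hN _ _ _ _ (by omega)]

lemma torsion_map {M N : GrBimod 𝒞 𝒜} (f : M ⟶ N) {n : ℤ} {x : M.X n}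
    (hx : x ∈ (torsion M).carrier n) : app f n x ∈ (torsion N).carrier n := by
  obtain ⟨N, hN⟩ := hx
  exact ⟨N, fun j m h a hj => by rw [← app_ract, hN j m h a hj, map_zero]⟩

variable (𝒞 𝒜) in
/-- The functor `Γ_𝔪` on `GrMod (Cᵒ ⊗ₖ A)`, where `𝔪 = A_{≥ 1}`. -/
def Gam : GrBimod 𝒞 𝒜 ⥤ GrBimod 𝒞 𝒜 where
  obj M := (torsion M).toBimod
  map {M N} f := (torsion N).lift ((torsion M).ι ≫ f) fun _ x => torsion_map f x.2

instance : (Gam 𝒞 𝒜).Additive where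

/-- The graded `Hom`: for a `B`-`A`-bimodule `M` and a `C`-`A`-bimodule `N`, the space
`Hom_{GrMod A}(M, N(n))` of families `M_i → N_{n+i}` that are compatible with the right action of
`A`. Such a family is encoded by all its matrix entries `M_i → N_j`, which vanish unless
`n + i = j`. -/
def homDeg (M : GrBimod ℬ 𝒜) (N : GrBimod 𝒞 𝒜) (n : ℤ) :
    Submodule k (∀ i j : ℤ, M.X i →ₗ[k] N.X j) where
  carrier := {f | (∀ i j, n + i ≠ j → f i j = 0) ∧
    ∀ (i j s i' j' : ℤ) (hi : i + s = i') (hj : j + s = j') (x : M.X i) (a : 𝒜 s),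
      f i' j' (M.ract hi x a) = N.ract hj (f i j x) a}
  add_mem' hf hg := ⟨fun i j h => by simp [hf.1 i j h, hg.1 i j h],
    fun i j s i' j' hi hj x a => by
      simp [hf.2 i j s i' j' hi hj x a, hg.2 i j s i' j' hi hj x a]⟩
  zero_mem' := ⟨fun _ _ _ => rfl, fun _ _ _ _ _ _ _ _ _ => by simp⟩
  smul_mem' r f hf := ⟨fun i j h => by simp [hf.1 i j h],
    fun i j s i' j' hi hj x a => by simp [hf.2 i j s i' j' hi hj x a]⟩

/-- The graded `Hom` of a `B`-`A`-bimodule and a `C`-`A`-bimodule as a `C`-`B`-bimodule, through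
`(c f)(x) = c f(x)` and `(f b)(x) = f(b x)`. -/
def homObj (M : GrBimod ℬ 𝒜) (N : GrBimod 𝒞 𝒜) : GrBimod 𝒞 ℬ where
  X n := homDeg M N n
  lact {p s n} h := LinearMap.mk₂ k
    (fun c f => ⟨fun i j => (N.lact (show p + (j - p) = j by omega) c).comp (f.1 i (j - p)),
      fun i j hij => by
        change (N.lact _ c).comp (f.1 i (j - p)) = 0
        rw [f.2.1 _ _ (by omega), LinearMap.comp_zero],
      fun i j s i' j' hi hj x a => by
        simp only [LinearMap.comp_apply]
        rw [f.2.2 i (j - p) s i' (j' - p) hi (by omega), ← N.lact_ract _ hj]⟩)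
    (fun _ _ _ => Subtype.ext (by ext; simp)) (fun _ _ _ => Subtype.ext (by ext; simp))
    (fun _ _ _ => Subtype.ext (by ext; simp)) (fun _ _ _ => Subtype.ext (by ext; simp))
  ract {s p n} h := LinearMap.mk₂ k
    (fun f b => ⟨fun i j => (f.1 (p + i) j).comp (M.lact rfl b),
      fun i j hij => by
        change (f.1 (p + i) j).comp _ = 0
        rw [f.2.1 _ _ (by omega), LinearMap.zero_comp],
      fun i j s i' j' hi hj x a => by
        simp only [LinearMap.comp_apply]
        rw [← f.2.2 (p + i) j s (p + i') j' (by omega) hj, M.lact_ract]⟩)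
    (fun _ _ _ => Subtype.ext (by ext; simp)) (fun _ _ _ => Subtype.ext (by ext; simp))
    (fun _ _ _ => Subtype.ext (by ext; simp)) (fun _ _ _ => Subtype.ext (by ext; simp))
  one_lact h f := Subtype.ext (by
    ext i j x
    have key : ∀ j' (h : 0 + j' = j), N.lact h (grOne 𝒞) (f.1 i j' x) = f.1 i j x := by
      intro j' h
      obtain rfl : j' = j := by omega
      exact N.one_lact _ _
    exact key (j - 0) (by omega))
  mul_lact {p q s r t n} hpq _ _ _ c c' f := Subtype.ext (by
    ext i j x
    have key : ∀ s s' t (_ : s = s') (hs : r + s = j) (h₁ : q + s' = t) (h₂ : p + t = j),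
        N.lact hs (grMul 𝒞 hpq c c') (f.1 i s x) = N.lact h₂ c (N.lact h₁ c' (f.1 i s' x)) := by
      rintro s _ t rfl hs h₁ h₂
      exact N.mul_lact _ _ _ _ _ _ _
    exact key (j - r) (j - p - q) (j - p) (by omega) (by omega) (by omega) (by omega))
  ract_one h f := Subtype.ext (by
    ext i j x
    have key : ∀ i' (h : 0 + i = i'), f.1 i' j (M.lact h (grOne ℬ) x) = f.1 i j x := by
      intro i' h
      obtain rfl : i = i' := by omega
      rw [M.one_lact]
    exact key (0 + i) rfl)
  ract_mul {s p q r t n} hpq _ _ _ f b b' := Subtype.ext (by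
    ext i j x
    have key : ∀ i₁ i₂ (_ : i₁ = i₂) (h₁ : r + i = i₁) (h₂ : p + (q + i) = i₂),
        f.1 i₁ j (M.lact h₁ (grMul ℬ hpq b b') x) = f.1 i₂ j (M.lact h₂ b (M.lact rfl b' x)) := by
      rintro i₁ _ rfl h₁ h₂
      rw [M.mul_lact hpq h₁ rfl h₂]
    exact key (r + i) (p + (q + i)) (by omega) rfl rfl)
  lact_ract _ _ _ _ _ _ _ := rfl

variable (𝒞) in
/-- The functor `Hom_A(M, -) : GrMod (Cᵒ ⊗ₖ A) ⥤ GrMod (Cᵒ ⊗ₖ B)` (graded `Hom`) for a graded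
`B`-`A`-bimodule `M`. -/
def homFunctor (M : GrBimod ℬ 𝒜) : GrBimod 𝒞 𝒜 ⥤ GrBimod 𝒞 ℬ where
  obj N := homObj M N
  map {N N'} g :=
    { app := fun n =>
        { toFun := fun (f : homDeg M N n) => (⟨fun i j => (app g j).comp (f.1 i j),
            fun i j h => by
              change (app g j).comp (f.1 i j) = 0
              rw [f.2.1 i j h, LinearMap.comp_zero],
            fun i j s i' j' hi hj x a => by
              simp only [LinearMap.comp_apply]
              rw [f.2.2 i j s i' j' hi hj, app_ract]⟩ : homDeg M N' n)
          map_add' := fun _ _ => Subtype.ext (by ext i j x; exact map_add (app g j) _ _)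
          map_smul' := fun _ _ => Subtype.ext (by ext i j x; exact map_smul (app g j) _ _) }
      map_lact := fun {p _ _} h c f => Subtype.ext (by
        ext i j x; exact app_lact g _ c _)
      map_ract := fun _ _ _ => rfl : Hom (homObj M N) (homObj M N') }

instance (M : GrBimod ℬ 𝒜) : (homFunctor 𝒞 M).Additive where
  map_add := hom_ext fun _ _ => Subtype.ext (by ext; rfl)

end GrBimod

/-! ## Derived categories and the regularity conditions -/

open GrBimod

instance : HasDerivedCategory (GrBimod 𝒞 𝒜) := HasDerivedCategory.standard _

variable (𝒜) in
/-- `RΓ_𝔪(A)` as an object of the derived category of graded `A`-`A`-bimodules. -/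
def RGam : DerivedCategory (GrBimod 𝒜 𝒜) :=
  DerivedCategory.Plus.ι.obj
    ((Gam 𝒜 𝒜).rightDerivedFunctorPlus.obj
      ((DerivedCategory.Plus.singleFunctor _ 0).obj (self 𝒜)))

variable (𝒜) in
/-- `RHom_A(R, A)` (graded `Hom` of right modules, `R = A_0`) as an object of the derived category
of graded `A`-`A`-bimodules. -/
def RHomDegZero [NatGraded 𝒜] : DerivedCategory (GrBimod 𝒜 𝒜) :=
  DerivedCategory.Plus.ι.obj
    ((homFunctor 𝒜 (degZero 𝒜)).rightDerivedFunctorPlus.obj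
      ((DerivedCategory.Plus.singleFunctor _ 0).obj (self 𝒜)))

/-- For an object `K` of the derived category of graded `A`-`A`-bimodules and a graded
`A`-`A`-bimodule `M`: `K ≅ M[-d]` both in the derived category of graded right `A`-modules and in
the derived category of graded left `A`-modules. -/
structure IsoOnBothSides (K : DerivedCategory (GrBimod 𝒜 𝒜)) (M : GrBimod 𝒜 𝒜) (d : ℤ) :
    Prop where
  right : Nonempty ((toRight 𝒜 𝒜).mapDerivedCategory.obj K ≅
    ((DerivedCategory.singleFunctor _ 0).obj ((toRight 𝒜 𝒜).obj M))⟦-d⟧)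
  left : Nonempty ((toLeft 𝒜 𝒜).mapDerivedCategory.obj K ≅
    ((DerivedCategory.singleFunctor _ 0).obj ((toLeft 𝒜 𝒜).obj M))⟦-d⟧)

/-- The global dimension of an abelian category, the supremum of the `i` for which
some `Ext^i(M, N)` is nonzero. -/
def gldim (𝓐 : Type*) [Category* 𝓐] [Abelian 𝓐] : WithBot ℕ∞ :=
  ⨆ M : 𝓐, projectiveDimension M

variable (𝒜) in
/-- Conditions common to AS-regular and ASF-regular `ℕ`-graded algebras: `A` is locally finite,
`gldim R < ∞` for `R = A_0`, and `gldim A = d`. -/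
structure IsLocallyFiniteOfGldim (d : ℕ) : Prop where
  locallyFinite : ∀ i, Module.Finite k (𝒜 i)
  gldim_degZero : gldim (ModuleCat.{u} (𝒜 0)ᵐᵒᵖ) < ⊤
  gldim_eq : gldim (ModuleCat.{u} Aᵐᵒᵖ) = d

variable (𝒜) in
/-- The `ℕ`-graded algebra `A` is ASF-regular of dimension `d` and of Gorenstein parameter `ℓ`:
moreover `RΓ_𝔪(A) ≅ DA(ℓ)[-d]` for graded right and for graded left modules. -/
structure IsASFRegular [NatGraded 𝒜] (d : ℕ) (ℓ : ℤ) : Prop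
    extends IsLocallyFiniteOfGldim 𝒜 d where
  iso : IsoOnBothSides (RGam 𝒜) ((dual (self 𝒜)).shift ℓ) d

variable (𝒜) in
/-- The `ℕ`-graded algebra `A` is AS-regular over `R = A_0` of dimension `d` and of Gorenstein
parameter `ℓ`: moreover `RHom_A(R, A) ≅ DR(ℓ)[-d]` for graded right and for graded left modules. -/
structure IsASRegular [NatGraded 𝒜] (d : ℕ) (ℓ : ℤ) : Prop
    extends IsLocallyFiniteOfGldim 𝒜 d where
  iso : IsoOnBothSides (RHomDegZero 𝒜) ((dual (degZero 𝒜)).shift ℓ) d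

/-! ## Condition (EF) -/

variable (𝒜) in
/-- The category `GrMod A` of graded right `A`-modules. -/
abbrev GrMod := GrBimod (ground k) 𝒜

variable (𝒜) in
/-- The free graded right module `A(n)`. -/
def freeMod (n : ℤ) : GrMod 𝒜 := (toRight 𝒜 𝒜).obj ((self 𝒜).shift n)

instance : HasFiniteBiproducts (GrBimod 𝒞 𝒜) := HasFiniteBiproducts.of_hasFiniteProducts

/-- Finitely generated graded right modules. -/
def IsFG (M : GrMod 𝒜) : Prop :=
  ∃ (r : ℕ) (n : Fin r → ℤ) (p : (⨁ fun s => freeMod 𝒜 (n s)) ⟶ M), Epi p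

/-- Finitely presented graded right modules. -/
def IsFP (M : GrMod 𝒜) : Prop :=
  ∃ (r : ℕ) (n : Fin r → ℤ) (p : (⨁ fun s => freeMod 𝒜 (n s)) ⟶ M), Epi p ∧ IsFG (kernel p)

/-- Graded right coherent modules: finitely generated, with every finitely generated graded
submodule finitely presented. -/
def IsCoherent (M : GrMod 𝒜) : Prop :=
  IsFG M ∧ ∀ (N : GrMod 𝒜) (i : N ⟶ M), Mono i → IsFG N → IsFP N

/-- Finite-dimensional graded right modules. -/
def IsFinDim (M : GrMod 𝒜) : Prop :=
  (∀ n, Module.Finite k (M.X n)) ∧ {n | Nontrivial (M.X n)}.Finite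

variable (𝒜) in
/-- Condition (EF): every finite-dimensional graded right `A`-module is graded right coherent. -/
def EF : Prop := ∀ M : GrMod 𝒜, IsFinDim M → IsCoherent M

end ASReg

end

/-!
# ASF-regular algebras are AS-regular over their degree-zero part

Let `K` be an injective resolution of `A` by graded `A`-`A`-bimodules. Its terms stay injective as
graded right modules (`injective_toRight_obj`), `RΓ_𝔪(A)` is `Γ_𝔪(K)`, and `RHom_A(R, A)` is
`Hom_A(R, K)`. Evaluation at `1` embeds `Hom_A(R, M)` into `Γ_𝔪(M)` with image the right socle of
`M`, that is, the elements killed by `A_{≥ 1}` (`evalOne`). So `Hom_A(R, K)` is the complex of right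
socles of `Γ_𝔪(K)`, and the question is how taking socles interacts with cohomology.

Suppose that `Γ_𝔪(K)` has cohomology in degree `d` only.

* The torsion part of an injective module is injective relative to torsion modules
  (`exists_extension_to_torsion`), so `Γ_𝔪(K)` splits over `A` in degrees up to `d`
  (`exists_splitting`). There taking socles commutes with cohomology: `Hom_A(R, K)` has no
  cohomology below `d`, and its cohomology in degree `d` is the socle of that of `Γ_𝔪(K)`
  (`homologyMap_evalComplex`).
* Above `d` the cohomology is `Ext^p_A(R, A)`, which vanishes as `gldim A = d`. The global dimension
  is that of ungraded modules. To use it, forgetting the grading is replaced by its right adjoint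
  `M ↦ M[t, t⁻¹]` (`constGr`), which is exact and preserves injectives (`injective_constGr`).
  Moreover the graded right module `A` is a direct summand of `A[t, t⁻¹]` (`selfToConst`,
  `constToSelf`). An extension class of `R(-m)` by `M[t, t⁻¹]` in degree above `d` is therefore zero
  (`ext_constGr_eq_zero`), which makes socle cocycles coboundaries of socle elements
  (`exists_socle_preimage`).

Finally, the cohomology of `Γ_𝔪(K)` in degree `d` is `DA(ℓ)` as a right module. The right socle of
`DA(ℓ)` is its component of degree `-ℓ` (`isSocle_dual_iff`). Hence `H^d(Hom_A(R, K))` is the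
component of degree `-ℓ` of `H^d(Γ_𝔪(K))`, as a bimodule, and `DR(ℓ)` is the component of degree `-ℓ`
of `DA(ℓ)`. A description by degrees passes through isomorphisms of right modules and through
isomorphisms of left modules, which gives the two identifications with `DR(ℓ)`.
-/

noncomputable section

/-! ### Derived functors through injective resolutions, and complexes with one cohomology object -/

namespace CategoryTheory

section DerivedFunctor

variable {C D : Type*} [Category* C] [Category* D] [Abelian C] [Abelian D]
  [HasDerivedCategory C] [HasDerivedCategory D]

/-- The right derived functor of `F` at an object is computed by applying `F` to an injective
resolution. -/
lemma InjectiveResolution.nonempty_rightDerivedFunctorPlus_iso [EnoughInjectives C]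
    (F : C ⥤ D) [F.Additive] {X : C} (R : InjectiveResolution X) :
    Nonempty (DerivedCategory.Plus.ι.obj (F.rightDerivedFunctorPlus.obj
      ((DerivedCategory.Plus.singleFunctor C 0).obj X)) ≅
      DerivedCategory.Q.obj ((F.mapHomologicalComplex (.up ℤ)).obj R.cochainComplex)) := by
  let K : CochainComplex.Plus C := ⟨R.cochainComplex, 0, inferInstance⟩
  have : ∀ n, Injective (((HomotopyCategory.Plus.quotient C).obj K).obj.as.X n) := fun n =>
    inferInstanceAs (Injective (R.cochainComplex.X n))
  have : IsIso (DerivedCategory.Q.map R.ι') :=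
    (DerivedCategory.isIso_Q_map_iff_quasiIso _ R.ι').2 inferInstance
  let e₀ := asIso (DerivedCategory.Q.map R.ι')
  let e₁ : (DerivedCategory.Plus.singleFunctor C 0).obj X ≅
      DerivedCategory.Plus.Qh.obj ((HomotopyCategory.Plus.quotient C).obj K) :=
    DerivedCategory.Plus.ι.preimageIso
      ((DerivedCategory.singleFunctorIsoCompQ C 0).app X ≪≫ e₀)
  let e₂ := asIso (F.rightDerivedFunctorPlusUnit.app ((HomotopyCategory.Plus.quotient C).obj K))
  exact ⟨DerivedCategory.Plus.ι.mapIso (F.rightDerivedFunctorPlus.mapIso e₁ ≪≫ e₂.symm) ≪≫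
    (DerivedCategory.quotientCompQhIso D).app _⟩

/-- An object of the derived category is a shifted single object if and only if it has the
corresponding cohomology objects. -/
lemma nonempty_iso_single_shift_iff (X : DerivedCategory C) (M : C) (d : ℤ) :
    Nonempty (X ≅ ((DerivedCategory.singleFunctor C 0).obj M)⟦-d⟧) ↔
      (∀ n ≠ d, IsZero ((DerivedCategory.homologyFunctor C n).obj X)) ∧
        Nonempty ((DerivedCategory.homologyFunctor C d).obj X ≅ M) := by
  let e₀ : ((DerivedCategory.singleFunctor C 0).obj M)⟦-d⟧ ≅
      (DerivedCategory.singleFunctor C d).obj M :=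
    ((DerivedCategory.singleFunctors C).shiftIso (-d) d 0 (by omega)).app M
  have hs : ∀ N : C, Nonempty ((DerivedCategory.homologyFunctor C d).obj
      ((DerivedCategory.singleFunctor C d).obj N) ≅ N) := fun N =>
    ⟨(DerivedCategory.homologyFunctor C d).mapIso
        ((DerivedCategory.singleFunctorIsoCompQ C d).app N) ≪≫
      (DerivedCategory.homologyFunctorFactors C d).app _ ≪≫
      (HomologicalComplex.homologyFunctorSingleIso C (.up ℤ) d).app N⟩
  constructor
  · rintro ⟨e⟩
    replace e := e ≪≫ e₀
    refine ⟨fun n hn => ?_, ?_⟩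
    · refine IsZero.of_iso ?_ ((DerivedCategory.homologyFunctor C n).mapIso e)
      rcases lt_or_gt_of_ne hn with h | h
      · exact DerivedCategory.isZero_of_isGE _ d n h
      · exact DerivedCategory.isZero_of_isLE _ d n h
    · obtain ⟨e'⟩ := hs M
      exact ⟨(DerivedCategory.homologyFunctor C d).mapIso e ≪≫ e'⟩
  · rintro ⟨h, ⟨e⟩⟩
    have : X.IsGE d := (DerivedCategory.isGE_iff X d).2 fun i hi => h i hi.ne
    have : X.IsLE d := (DerivedCategory.isLE_iff X d).2 fun i hi => h i hi.ne'
    obtain ⟨Y, ⟨f⟩⟩ := DerivedCategory.exists_iso_singleFunctor_obj_of_isGE_of_isLE X d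
    obtain ⟨e'⟩ := hs Y
    exact ⟨f ≪≫ (DerivedCategory.singleFunctor C d).mapIso
      (e'.symm ≪≫ ((DerivedCategory.homologyFunctor C d).mapIso f).symm ≪≫ e) ≪≫ e₀.symm⟩

/-- The cohomology of the image of a complex under an exact functor between derived categories. -/
lemma nonempty_homology_mapDerivedCategory_iso (F : C ⥤ D) [F.Additive] [PreservesFiniteLimits F]
    [PreservesFiniteColimits F] {X : DerivedCategory C} {L : CochainComplex C ℤ}
    (e : X ≅ DerivedCategory.Q.obj L) (n : ℤ) :
    Nonempty ((DerivedCategory.homologyFunctor D n).obj (F.mapDerivedCategory.obj X) ≅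
      F.obj (L.homology n)) :=
  ⟨(DerivedCategory.homologyFunctor D n).mapIso
      (F.mapDerivedCategory.mapIso e ≪≫ F.mapDerivedCategoryFactors.app L) ≪≫
    (DerivedCategory.homologyFunctorFactors D n).app _ ≪≫ (L.sc n).mapHomologyIso F⟩

/-- The image of a complex under an exact functor is a shifted single object if and only if the
images of the cohomology objects are the expected ones. -/
lemma nonempty_mapDerivedCategory_iso_single_shift_iff (F : C ⥤ D) [F.Additive]
    [PreservesFiniteLimits F] [PreservesFiniteColimits F] {X : DerivedCategory C}
    {L : CochainComplex C ℤ} (e : X ≅ DerivedCategory.Q.obj L) (M : D) (d : ℤ) :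
    Nonempty (F.mapDerivedCategory.obj X ≅ ((DerivedCategory.singleFunctor D 0).obj M)⟦-d⟧) ↔
      (∀ n ≠ d, IsZero (F.obj (L.homology n))) ∧ Nonempty (F.obj (L.homology d) ≅ M) := by
  rw [nonempty_iso_single_shift_iff]
  refine and_congr (forall₂_congr fun n _ => ?_) ?_
  · obtain ⟨e'⟩ := nonempty_homology_mapDerivedCategory_iso F e n
    exact e'.isZero_iff
  · obtain ⟨e'⟩ := nonempty_homology_mapDerivedCategory_iso F e d
    exact ⟨fun ⟨f⟩ => ⟨e'.symm ≪≫ f⟩, fun ⟨f⟩ => ⟨e' ≪≫ f⟩⟩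

end DerivedFunctor

section Resolution

variable {C D : Type*} [Category* C] [Category* D] [Abelian C] [Abelian D]

/-- The image of an injective resolution under an exact functor that preserves injectives. -/
def InjectiveResolution.mapOfExact (F : C ⥤ D) [F.Additive] [PreservesFiniteLimits F]
    [PreservesFiniteColimits F] (hF : ∀ E : C, Injective E → Injective (F.obj E)) {X : C}
    (R : InjectiveResolution X) : InjectiveResolution (F.obj X) where
  cocomplex := (F.mapHomologicalComplex _).obj R.cocomplex
  injective n := hF _ (R.injective n)
  ι := (HomologicalComplex.singleMapHomologicalComplex F (.up ℕ) 0).inv.app X ≫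
    (F.mapHomologicalComplex _).map R.ι
  quasiIso := by
    have : QuasiIso ((F.mapHomologicalComplex (.up ℕ)).map R.ι) := inferInstance
    infer_instance

end Resolution

end CategoryTheory


/-! ### Cohomology of complexes of graded bimodules, elementwise -/

namespace ASReg

open GrBimod

variable {k : Type u} [Field k] {A C : Type u} [Ring A] [Algebra k A] [Ring C] [Algebra k C]
  {𝒞 : ℤ → Submodule k C} [SetLike.GradedMonoid 𝒞] {𝒜 : ℤ → Submodule k A}
  [SetLike.GradedMonoid 𝒜]

section Homology

variable (L : CochainComplex (GrBimod 𝒞 𝒜) ℤ)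

lemma isZero_homology_iff {i j l : ℤ} (hij : i + 1 = j) (hjl : j + 1 = l) :
    IsZero (L.homology j) ↔
      ∀ n x, app (L.d j l) n x = 0 → ∃ y, app (L.d i j) n y = x := by
  rw [← HomologicalComplex.exactAt_iff_isZero_homology,
    L.exactAt_iff' i j l (by simp [← hij]) (by simp [← hjl]), exact_iff]
  rfl

lemma d_d_apply {i j l n : ℤ} (x : (L.X i).X n) : app (L.d j l) n (app (L.d i j) n x) = 0 := by
  rw [← GrBimod.comp_apply, L.d_comp_d]; rfl

lemma exists_iCycles_eq {j l n : ℤ} (hjl : j + 1 = l) (x : (L.X j).X n)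
    (hx : app (L.d j l) n x = 0) : ∃ z, app (L.iCycles j) n z = x :=
  (exact_iff _).1 (ShortComplex.exact_of_f_is_kernel
    (ShortComplex.mk (L.iCycles j) (L.d j l) (L.iCycles_d j l))
    (L.cyclesIsKernel j l (by simp [← hjl]))) n x hx

lemma homologyπ_eq_zero_iff {i j n : ℤ} (hij : i + 1 = j) (z : (L.cycles j).X n) :
    app (L.homologyπ j) n z = 0 ↔ ∃ y, app (L.d i j) n y = app (L.iCycles j) n z := by
  have hd : ∀ y, app (L.iCycles j) n (app (L.toCycles i j) n y) = app (L.d i j) n y := fun y => by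
    rw [← GrBimod.comp_apply, L.toCycles_i]
  constructor
  · intro h
    obtain ⟨y, hy⟩ := (exact_iff _).1 (ShortComplex.exact_of_g_is_cokernel
      (ShortComplex.mk (L.toCycles i j) (L.homologyπ j) (L.toCycles_comp_homologyπ i j))
      (L.homologyIsCokernel i j (by simp [← hij]))) n z h
    exact ⟨y, by rw [← hd]; exact congrArg _ hy⟩
  · rintro ⟨y, hy⟩
    rw [← hd] at hy
    rw [← injective_of_mono (L.iCycles j) n hy, ← GrBimod.comp_apply, L.toCycles_comp_homologyπ]; rfl

lemma homologyπ_homologyMap {L L' : CochainComplex (GrBimod 𝒞 𝒜) ℤ} (f : L ⟶ L') {j n : ℤ}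
    (z : (L.cycles j).X n) : app (HomologicalComplex.homologyMap f j) n (app (L.homologyπ j) n z) =
      app (L'.homologyπ j) n (app (HomologicalComplex.cyclesMap f j) n z) := by
  rw [← GrBimod.comp_apply, HomologicalComplex.homologyπ_naturality]; rfl

lemma iCycles_cyclesMap {L L' : CochainComplex (GrBimod 𝒞 𝒜) ℤ} (f : L ⟶ L') {j n : ℤ}
    (z : (L.cycles j).X n) : app (L'.iCycles j) n (app (HomologicalComplex.cyclesMap f j) n z) =
      app (f.f j) n (app (L.iCycles j) n z) := by
  rw [← GrBimod.comp_apply, HomologicalComplex.cyclesMap_i]; rfl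

end Homology

/-! ### Right modules -/

section RightModules

lemma ground_coe (c : ground k 0) : c = (c : k) • grOne (ground k) := Subtype.ext (by simp)

lemma ground_eq_zero {i : ℤ} (hi : i ≠ 0) (c : ground k i) : c = 0 :=
  Subtype.ext (by simpa [ground, hi] using c.2)

/-- A morphism of graded right modules from a family of linear maps compatible with the right
action: compatibility with the left action of the ground field is automatic. -/
def homOfRact {M N : GrMod 𝒜} (f : ∀ n, M.X n →ₗ[k] N.X n)
    (hf : ∀ {i j n : ℤ} (h : i + j = n) (x : M.X i) (a : 𝒜 j),
      f n (M.ract h x a) = N.ract h (f i x) a) : M ⟶ N :=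
  { app := f
    map_lact := fun {i j n} h c x => by
      by_cases hi : i = 0
      · subst hi
        obtain rfl : j = n := by omega
        rw [ground_coe c, map_smul, map_smul, LinearMap.smul_apply, LinearMap.smul_apply,
          M.one_lact, N.one_lact, map_smul]
      · rw [ground_eq_zero hi c, map_zero, map_zero, LinearMap.zero_apply, LinearMap.zero_apply,
          map_zero]
    map_ract := hf : Hom M N }

/-- The elements annihilated by `A_{≥ 1}` from the right. -/
def IsSocle (M : GrBimod 𝒞 𝒜) {n : ℤ} (x : M.X n) : Prop :=
  ∀ (j m : ℤ) (h : n + j = m) (a : 𝒜 j), 1 ≤ j → M.ract h x a = 0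

lemma IsSocle.map {M N : GrBimod 𝒞 𝒜} (f : M ⟶ N) {n : ℤ} {x : M.X n} (hx : IsSocle M x) :
    IsSocle N (app f n x) := fun j m h a hj => by
  rw [← app_ract, hx j m h a hj, map_zero]

lemma IsSocle.mem_torsion {M : GrBimod 𝒞 𝒜} {n : ℤ} {x : M.X n} (hx : IsSocle M x) :
    x ∈ (torsion M).carrier n := ⟨1, hx⟩

end RightModules

/-! ### Restricting injective bimodules to right modules -/

section Injective

variable (V : ℤ → Type u) [∀ n, AddCommGroup (V n)] [∀ n, Module k (V n)]

lemma cofree_ract_apply {s j n : ℤ} (h : s + j = n) (f : (cofree 𝒞 𝒜 V).X s) (a : 𝒜 j)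
    (i j' m : ℤ) (c : 𝒞 i) (a' : 𝒜 j') :
    ((cofree 𝒞 𝒜 V).ract h f a).1 i j' m c a' = f.1 i (j + j') m c (grMul 𝒜 rfl a a') := rfl

/-- The coinduced bimodule on `V` is, as a right module, a retract of the right module coinduced
from it, through the retraction `F ↦ ((c, a) ↦ F(a)(c, 1))`. -/
def cofreeRightRetraction :
    cofree (ground k) 𝒜 ((toRight 𝒞 𝒜).obj (cofree 𝒞 𝒜 V)).X ⟶
      (toRight 𝒞 𝒜).obj (cofree 𝒞 𝒜 V) :=
  homOfRact
    (fun n =>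
      { toFun := fun F => (⟨fun i j m => LinearMap.mk₂ k
            (fun c a => ((F.1 0 j (n + j) (grOne (ground k)) a : (cofree 𝒞 𝒜 V).X (n + j))).1
              i 0 m c (grOne 𝒜))
            (fun _ _ _ => by rw [map_add, LinearMap.add_apply])
            (fun _ _ _ => by rw [map_smul, LinearMap.smul_apply])
            (fun _ _ _ => by rw [map_add]; rfl)
            (fun _ _ _ => by rw [map_smul]; rfl),
          fun i j m hm => by
            ext c a
            change ((F.1 0 j (n + j) (grOne (ground k)) a : (cofree 𝒞 𝒜 V).X (n + j))).1
              i 0 m c (grOne 𝒜) = 0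
            rw [(F.1 0 j (n + j) (grOne (ground k)) a : (cofree 𝒞 𝒜 V).X (n + j)).2 i 0 m
              (by omega)]
            rfl⟩ : (cofree 𝒞 𝒜 V).X n)
        map_add' := fun _ _ => rfl
        map_smul' := fun _ _ => rfl })
    (fun {s j n} h F b => Subtype.ext (by
      subst h
      ext i j' m c a
      change ((F.1 0 (j + j') (s + j + j') (grOne (ground k)) (grMul 𝒜 rfl b a) :
          (cofree 𝒞 𝒜 V).X (s + j + j'))).1 i 0 m c (grOne 𝒜) =
        ((F.1 0 (j + j') (s + (j + j')) (grOne (ground k)) (grMul 𝒜 rfl b a) :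
          (cofree 𝒞 𝒜 V).X (s + (j + j')))).1 i 0 m c (grOne 𝒜)
      rw [add_assoc s j j']))

lemma cofreeLift_retraction :
    cofreeLift (M := (toRight 𝒞 𝒜).obj (cofree 𝒞 𝒜 V)) (fun _ => LinearMap.id) ≫
      cofreeRightRetraction V = 𝟙 _ := by
  refine hom_ext fun n x => Subtype.ext ?_
  ext i j m c a
  change ((cofreeLiftAux (M := (toRight 𝒞 𝒜).obj (cofree 𝒞 𝒜 V))
    (fun _ => LinearMap.id) x 0 j (n + j) (grOne (ground k)) a :
      (cofree 𝒞 𝒜 V).X (n + j))).1 i 0 m c (grOne 𝒜) = x.1 i j m c a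
  rw [cofreeLiftAux_apply _ _ (zero_add n) rfl, GrBimod.one_lact]
  change x.1 i (j + 0) m c (grMul 𝒜 rfl a (grOne 𝒜)) = _
  have key : ∀ j₁ (_ : j = j₁) (a₁ : 𝒜 j₁), (a : A) = a₁ → x.1 i j₁ m c a₁ = x.1 i j m c a := by
    rintro _ rfl c₁ e; rw [Subtype.ext e]
  exact key (j + 0) (by omega) _ (by simp)

instance injective_toRight_cofree : Injective ((toRight 𝒞 𝒜).obj (cofree 𝒞 𝒜 V)) :=
  Retract.injective (Y := cofree (ground k) 𝒜 ((toRight 𝒞 𝒜).obj (cofree 𝒞 𝒜 V)).X)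
    ⟨_, _, cofreeLift_retraction V⟩

/-- An injective bimodule is injective as a right module: it is a direct summand of a coinduced
bimodule. -/
lemma injective_toRight_obj (I : GrBimod 𝒞 𝒜) (_ : Injective I) :
    Injective ((toRight 𝒞 𝒜).obj I) := by
  let i : I ⟶ cofree 𝒞 𝒜 I.X := cofreeLift fun _ => LinearMap.id
  have : Mono i := mono_of_injective _ fun n x y h => by
    rw [← LinearMap.id_apply (R := k) x, ← LinearMap.id_apply (R := k) y,
      ← cofreeEval_lift (fun n => (LinearMap.id : I.X n →ₗ[k] I.X n)), h, cofreeEval_lift]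
  exact Retract.injective (Y := (toRight 𝒞 𝒜).obj (cofree 𝒞 𝒜 I.X))
    ((Retract.mk i (Injective.factorThru (𝟙 I) i) (Injective.comp_factorThru _ _)).map
      (toRight 𝒞 𝒜))

end Injective

end ASReg


namespace ASReg

open GrBimod

variable {k : Type u} [Field k] {A C : Type u} [Ring A] [Algebra k A] [Ring C] [Algebra k C]
  {𝒞 : ℤ → Submodule k C} [SetLike.GradedMonoid 𝒞] {𝒜 : ℤ → Submodule k A}
  [SetLike.GradedMonoid 𝒜]

/-! ### The torsion part of an injective complex splits below its first cohomology -/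

section Torsion

/-- Torsion submodules of injective modules are injective relative to torsion modules: if
`M → N → P` is exact, `P` is torsion, and `I` is injective as a right module, then a map from `N`
to the torsion part of `I` that vanishes on `M` extends to `P`. -/
lemma exists_extension_to_torsion {M N P : GrMod 𝒜} (f : M ⟶ N) (g : N ⟶ P)
    (hfg : ∀ n x, app g n x = 0 → ∃ y, app f n y = x)
    (hP : ∀ n (x : P.X n), x ∈ (torsion P).carrier n) (I : GrBimod 𝒞 𝒜)
    [Injective ((toRight 𝒞 𝒜).obj I)] (e : N ⟶ (toRight 𝒞 𝒜).obj (torsion I).toBimod)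
    (he : f ≫ e = 0) : ∃ t, g ≫ t = e := by
  let incl := (toRight 𝒞 𝒜).map (torsion I).ι
  have hincl : ∀ n, Function.Injective (app incl n) := fun n => Subtype.val_injective
  -- First extend to a map into `I`, then observe that its values are torsion.
  have hext : ∃ t' : P ⟶ (toRight 𝒞 𝒜).obj I, g ≫ t' = e ≫ incl := by
    let q : N ⟶ (range g).toBimod := (range g).lift g fun n x => ⟨x, rfl⟩
    have hker : ∀ n x, app q n x = 0 → app (e ≫ incl) n x = 0 := fun n x hx => by
      obtain ⟨y, rfl⟩ := hfg n x (congrArg Subtype.val hx)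
      rw [← GrBimod.comp_apply, ← Category.assoc, he, zero_comp]; rfl
    have hsurj : ∀ n, Function.Surjective (app q n) := by
      rintro n ⟨_, x, rfl⟩
      exact ⟨x, rfl⟩
    refine ⟨Injective.factorThru (descSurj q hsurj _ hker) (range g).ι, ?_⟩
    exact (Category.assoc q (range g).ι _).trans
      ((congrArg (q ≫ ·) (Injective.comp_factorThru _ _)).trans (comp_descSurj _ _ _ _))
  obtain ⟨t', ht'⟩ := hext
  refine ⟨liftInj incl hincl t' fun n x =>
    ⟨(⟨app t' n x, torsion_map t' (hP n x)⟩ : (torsion I).carrier n), rfl⟩, ?_⟩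
  have : Mono incl := mono_of_injective _ hincl
  rw [← cancel_mono incl, ← ht']
  exact (Category.assoc _ _ _).trans (congrArg (g ≫ ·) (liftInj_comp _ _ _ _))

variable (K : CochainComplex (GrBimod 𝒞 𝒜) ℤ)

/-- The complex `Γ_𝔪(K)`. -/
abbrev gamComplex : CochainComplex (GrBimod 𝒞 𝒜) ℤ :=
  ((Gam 𝒞 𝒜).mapHomologicalComplex (.up ℤ)).obj K

lemma mem_torsion_gamComplex {p n : ℤ} (x : ((gamComplex K).X p).X n) :
    x ∈ (torsion ((gamComplex K).X p)).carrier n := by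
  obtain ⟨N, hN⟩ := x.2
  exact ⟨N, fun j m h a hj => Subtype.ext (hN j m h a hj)⟩

/-- Let `K` be a bounded below complex of injectives such that `Γ_𝔪(K)` has no cohomology below
degree `d`. Then, as a complex of right modules, `Γ_𝔪(K)` splits in degrees up to `d`: each
differential `δ` into these degrees has a map `s` in the opposite direction with `δ s δ = δ`. If
`s` is known for `δ`, then `1 - s δ` vanishes on the image of `δ`, which is the kernel of the next
differential, and so it extends along the latter, and the extension is the next `s`. -/
lemma exists_splitting [K.IsStrictlyGE 0] (hK : ∀ p, Injective ((toRight 𝒞 𝒜).obj (K.X p)))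
    {d : ℤ} (hd : ∀ p < d, IsZero ((gamComplex K).homology p)) {i j : ℤ} (hij : i + 1 = j)
    (hj : j ≤ d) :
    ∃ s : (toRight 𝒞 𝒜).obj ((gamComplex K).X j) ⟶ (toRight 𝒞 𝒜).obj ((gamComplex K).X i),
      ∀ n x, app ((gamComplex K).d i j) n (app s n (app ((gamComplex K).d i j) n x)) =
        app ((gamComplex K).d i j) n x := by
  suffices H : ∀ N : ℕ, ∀ i j : ℤ, i + 1 = j → j = N → j ≤ d →
      ∃ s : (toRight 𝒞 𝒜).obj ((gamComplex K).X j) ⟶ (toRight 𝒞 𝒜).obj ((gamComplex K).X i),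
      ∀ n x, app ((gamComplex K).d i j) n (app s n (app ((gamComplex K).d i j) n x)) =
        app ((gamComplex K).d i j) n x by
    by_cases h0 : j < 0
    · have hz : IsZero (K.X i) := K.isZero_of_isStrictlyGE 0 i (by omega)
      have hd0 : (gamComplex K).d i j = 0 :=
        IsZero.eq_of_src ((Gam 𝒞 𝒜).map_isZero hz) _ _
      exact ⟨0, fun n x => by rw [hd0]; rfl⟩
    · exact H j.toNat i j hij (by omega) hj
  intro N
  induction N with
  | zero =>
    intro i j hij hj0 hj
    have hz : IsZero (K.X i) := K.isZero_of_isStrictlyGE 0 i (by simp at hj0; omega)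
    have hd0 : (gamComplex K).d i j = 0 :=
      IsZero.eq_of_src ((Gam 𝒞 𝒜).map_isZero hz) _ _
    exact ⟨0, fun n x => by rw [hd0]; rfl⟩
  | succ N ih =>
    intro j l hjl hl hld
    obtain ⟨s, hs⟩ := ih (j - 1) j (by omega) (by push_cast at hl; omega) (by omega)
    have hex := (isZero_homology_iff (gamComplex K) (show j - 1 + 1 = j by omega) hjl).1
      (hd j (by omega))
    let δ := (toRight 𝒞 𝒜).map ((gamComplex K).d (j - 1) j)
    let δ' := (toRight 𝒞 𝒜).map ((gamComplex K).d j l)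
    have := hK j
    have hcomp : δ ≫ (𝟙 _ - s ≫ δ) = 0 := by
      rw [Preadditive.comp_sub, Category.comp_id, sub_eq_zero]
      exact hom_ext fun n x => (hs n x).symm
    obtain ⟨t, ht⟩ := exists_extension_to_torsion δ δ' hex
      (fun n x => by
        obtain ⟨N, hN⟩ := mem_torsion_gamComplex K x
        exact ⟨N, hN⟩) (K.X j) (𝟙 _ - s ≫ δ) hcomp
    refine ⟨t, fun n x => ?_⟩
    have h1 : ∀ x : ((toRight 𝒞 𝒜).obj ((gamComplex K).X j)).X n,
        app t n (app δ' n x) = x - app δ n (app s n x) := fun x => by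
      rw [← GrBimod.comp_apply, ht]; rfl
    have h2 : app δ' n (app δ n (app s n x)) = 0 :=
      d_d_apply (gamComplex K) (i := j - 1) (j := j) (l := l) (app s n x)
    exact (congrArg (app δ' n) (h1 x)).trans ((map_sub _ _ _).trans (by rw [h2, sub_zero]; rfl))

variable {K} [K.IsStrictlyGE 0] (hK : ∀ p, Injective ((toRight 𝒞 𝒜).obj (K.X p)))
  {d : ℤ} (hd : ∀ p < d, IsZero ((gamComplex K).homology p)) {i j : ℤ} (hij : i + 1 = j)
  (hj : j ≤ d)

include hK hd hij hj

/-- A coboundary in `Γ_𝔪(K)` that lies in the socle is the coboundary of an element of the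
socle. -/
lemma exists_socle_of_boundary {n : ℤ} (y : ((gamComplex K).X i).X n)
    (hy : IsSocle ((gamComplex K).X j) (app ((gamComplex K).d i j) n y)) :
    ∃ y', IsSocle ((gamComplex K).X i) y' ∧
      app ((gamComplex K).d i j) n y' = app ((gamComplex K).d i j) n y := by
  obtain ⟨s, hs⟩ := exists_splitting K hK hd hij hj
  exact ⟨app s n (app ((gamComplex K).d i j) n y),
    IsSocle.map (M := (toRight 𝒞 𝒜).obj ((gamComplex K).X j)) s hy, hs n y⟩

/-- A class annihilated by `A_{≥ 1}` has a representative annihilated by `A_{≥ 1}`. -/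
lemma exists_socle_representative {n : ℤ} (z : ((gamComplex K).X j).X n)
    (hz : ∀ (t m : ℤ) (h : n + t = m) (a : 𝒜 t), 1 ≤ t →
      ∃ y, app ((gamComplex K).d i j) m y = ((gamComplex K).X j).ract h z a) :
    ∃ y, IsSocle ((gamComplex K).X j) (z - app ((gamComplex K).d i j) n y) := by
  obtain ⟨s, hs⟩ := exists_splitting K hK hd hij hj
  refine ⟨app s n z, fun t m h a ht => ?_⟩
  obtain ⟨y, hy⟩ := hz t m h a ht
  have h1 : app s m (((gamComplex K).X j).ract h z a) =
      ((gamComplex K).X i).ract h (app s n z) a :=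
    app_ract (M := (toRight 𝒞 𝒜).obj ((gamComplex K).X j))
      (N := (toRight 𝒞 𝒜).obj ((gamComplex K).X i)) s h z a
  have h2 := app_ract ((gamComplex K).d i j) h (app s n z) a
  rw [map_sub, LinearMap.sub_apply, sub_eq_zero]
  refine Eq.trans ?_ h2
  rw [← h1, ← hy]
  exact (hs m y).symm

end Torsion

/-! ### Graded homomorphisms from `R` -/

section Evaluation

variable [NatGraded 𝒜]

variable (𝒜) in
/-- The projection `A → A / A_{≥ 1} = R`. -/
def degZeroπ : self 𝒜 ⟶ degZero 𝒜 := (augmentation 𝒜).π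

lemma degZeroπ_surjective (i : ℤ) (r : (degZero 𝒜).X i) : ∃ a : 𝒜 i, app (degZeroπ 𝒜) i a = r :=
  (augmentation 𝒜).π_surjective i r

variable (𝒜) in
/-- The unit of `R = A_0` in the bimodule `A / A_{≥ 1}`. -/
def degZeroOne : (degZero 𝒜).X 0 := app (degZeroπ 𝒜) 0 (grOne 𝒜)

lemma degZeroOne_ract {i : ℤ} (h : 0 + i = i) (a : 𝒜 i) :
    (degZero 𝒜).ract h (degZeroOne 𝒜) a = app (degZeroπ 𝒜) i a :=
  congrArg (app (degZeroπ 𝒜) i) (Subtype.ext (one_mul (a : A)))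

lemma degZeroOne_lact {i : ℤ} (h : i + 0 = i) (a : 𝒜 i) :
    (degZero 𝒜).lact h a (degZeroOne 𝒜) = app (degZeroπ 𝒜) i a :=
  congrArg (app (degZeroπ 𝒜) i) (Subtype.ext (mul_one (a : A)))

lemma degZero_π_eq_zero {i : ℤ} (hi : 1 ≤ i) (a : 𝒜 i) : app (degZeroπ 𝒜) i a = 0 :=
  ((augmentation 𝒜).π_eq_zero_iff _).2 (by
    change a ∈ (if 1 ≤ i then (⊤ : Submodule k (𝒜 i)) else ⊥)
    rw [if_pos hi]; trivial)

lemma mem_augmentation {i : ℤ} (a : 𝒜 i) (ha : a ∈ (augmentation 𝒜).carrier i) (hi : ¬ 1 ≤ i) :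
    a = 0 := by
  change a ∈ (if 1 ≤ i then (⊤ : Submodule k (𝒜 i)) else ⊥) at ha
  rwa [if_neg hi, Submodule.mem_bot] at ha

/-- A graded homomorphism from `R` is determined by its value at `1`. -/
lemma homDeg_apply {N : GrBimod 𝒞 𝒜} {n : ℤ} (f : homDeg (degZero 𝒜) N n) {i j : ℤ}
    (h : n + i = j) (a : 𝒜 i) :
    f.1 i j (app (degZeroπ 𝒜) i a) = N.ract h (f.1 0 n (degZeroOne 𝒜)) a := by
  rw [← degZeroOne_ract (zero_add i) a, f.2.2 0 n i i j (zero_add i) h]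

lemma isSocle_homDeg_apply {N : GrBimod 𝒞 𝒜} {n : ℤ} (f : homDeg (degZero 𝒜) N n) :
    IsSocle N (f.1 0 n (degZeroOne 𝒜)) := fun j m h a hj => by
  rw [← homDeg_apply f h a, degZero_π_eq_zero hj, map_zero]

variable (𝒞 𝒜) in
/-- Evaluation at `1`, as a natural transformation `Hom_A(R, -) ⟶ Γ_𝔪`. -/
def evalOne : homFunctor 𝒞 (degZero 𝒜) ⟶ Gam 𝒞 𝒜 where
  app N :=
    { app := fun n =>
        { toFun := fun (f : homDeg (degZero 𝒜) N n) =>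
            (⟨f.1 0 n (degZeroOne 𝒜), (isSocle_homDeg_apply f).mem_torsion⟩ :
              (torsion N).carrier n)
          map_add' := fun _ _ => rfl
          map_smul' := fun _ _ => rfl }
      map_lact := fun {p s n} h c (f : homDeg (degZero 𝒜) N s) => Subtype.ext (by
        change N.lact _ c (f.1 0 (n - p) (degZeroOne 𝒜)) = N.lact h c (f.1 0 s (degZeroOne 𝒜))
        obtain rfl : s = n - p := by omega
        rfl)
      map_ract := fun {s p n} h (f : homDeg (degZero 𝒜) N s) b => Subtype.ext (by
        change f.1 (p + 0) n ((degZero 𝒜).lact rfl b (degZeroOne 𝒜)) =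
          N.ract h (f.1 0 s (degZeroOne 𝒜)) b
        have key : ∀ q (hq : p + 0 = q), f.1 q n ((degZero 𝒜).lact hq b (degZeroOne 𝒜)) =
            N.ract h (f.1 0 s (degZeroOne 𝒜)) b := by
          intro q hq
          obtain rfl : p = q := by omega
          rw [degZeroOne_lact, homDeg_apply f h b]
        exact key _ rfl) : Hom (homObj (degZero 𝒜) N) (torsion N).toBimod }
  naturality _ _ _ := rfl

lemma evalOne_injective (N : GrBimod 𝒞 𝒜) (n : ℤ) :
    Function.Injective (app ((evalOne 𝒞 𝒜).app N) n) := by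
  intro (f : homDeg (degZero 𝒜) N n) (g : homDeg (degZero 𝒜) N n) hfg
  have h0 : f.1 0 n (degZeroOne 𝒜) = g.1 0 n (degZeroOne 𝒜) := congrArg Subtype.val hfg
  refine Subtype.ext (funext fun i => funext fun j => LinearMap.ext fun x => ?_)
  by_cases h : n + i = j
  · obtain ⟨a, rfl⟩ := degZeroπ_surjective i x
    rw [homDeg_apply f h, homDeg_apply g h, h0]
  · rw [f.2.1 i j h, g.2.1 i j h]

lemma isSocle_evalOne (N : GrBimod 𝒞 𝒜) {n : ℤ} (f) :
    IsSocle ((Gam 𝒞 𝒜).obj N) (app ((evalOne 𝒞 𝒜).app N) n f) :=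
  fun j m h a hj => Subtype.ext (isSocle_homDeg_apply f j m h a hj)

/-- Every element of the socle is the value at `1` of a homomorphism from `R`. -/
lemma exists_evalOne_eq (N : GrBimod 𝒞 𝒜) {n : ℤ} (x : ((Gam 𝒞 𝒜).obj N).X n)
    (hx : IsSocle ((Gam 𝒞 𝒜).obj N) x) : ∃ f, app ((evalOne 𝒞 𝒜).app N) n f = x := by
  have hx' : IsSocle N x.1 := fun j m h a hj => congrArg Subtype.val (hx j m h a hj)
  let f₀ : ∀ i j : ℤ, (degZero 𝒜).X i →ₗ[k] N.X j := fun i j =>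
    if h : n + i = j then ((augmentation 𝒜).carrier i).liftQ (N.ract h x.1) (fun a ha => by
      by_cases hi : 1 ≤ i
      · exact hx' i j h a hi
      · rw [mem_augmentation a ha hi]; exact Submodule.zero_mem _) else 0
  have hf₀ : ∀ {i j : ℤ} (h : n + i = j) (a : 𝒜 i),
      f₀ i j (app (degZeroπ 𝒜) i a) = N.ract h x.1 a := fun {i j} h a => by
    have : f₀ i j = ((augmentation 𝒜).carrier i).liftQ (N.ract h x.1) _ := dif_pos h
    rw [this]; rfl
  refine ⟨(⟨f₀, fun i j h => dif_neg h, fun i j s i' j' hi hj r a => ?_⟩ :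
    homDeg (degZero 𝒜) N n), Subtype.ext ?_⟩
  · obtain ⟨b, rfl⟩ := degZeroπ_surjective i r
    refine (congrArg (f₀ i' j') (app_ract (degZeroπ 𝒜) hi b a)).symm.trans ?_
    change f₀ i' j' (app (degZeroπ 𝒜) i' (grMul 𝒜 hi b a)) = _
    by_cases h : n + i = j
    · rw [hf₀ h, hf₀ (show n + i' = j' by omega), ← N.ract_mul hi (by omega) h hj]
    · have h' : n + i' ≠ j' := by omega
      have hz : f₀ i j = 0 := dif_neg h
      have hz' : f₀ i' j' = 0 := dif_neg h'
      rw [hz, hz', LinearMap.zero_apply, LinearMap.zero_apply, map_zero, LinearMap.zero_apply]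
  · change f₀ 0 n (degZeroOne 𝒜) = x.1
    rw [degZeroOne, hf₀ (add_zero n), N.ract_one]

end Evaluation

end ASReg


namespace ASReg

open GrBimod MulOpposite
open scoped ModuleCat

variable {k : Type u} [Field k] {A : Type u} [Ring A] [Algebra k A]
  {𝒜 : ℤ → Submodule k A}

/-! ### The right adjoint of forgetting the grading -/

section Const

variable [SetLike.GradedMonoid 𝒜]

variable (𝒜) in
/-- The graded right module with all components equal to the ungraded right module `M`, that is,
`M[t, t⁻¹]`. -/
def constGr (M : ModuleCat.{u} Aᵐᵒᵖ) : GrMod 𝒜 where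
  X _ := M
  lact _ := LinearMap.mk₂ k (fun c x => (c : k) • x)
    (fun _ _ _ => add_smul _ _ _) (fun _ _ _ => mul_smul _ _ _)
    (fun _ _ _ => smul_add _ _ _) (fun _ _ _ => smul_comm _ _ _)
  ract _ := LinearMap.mk₂ k (fun x a => op (a : A) • x)
    (fun _ _ _ => smul_add _ _ _) (fun _ _ _ => smul_comm _ _ _)
    (fun x a a' => add_smul (op (a : A)) (op (a' : A)) x)
    (fun r x a => smul_assoc r (op (a : A)) x)
  one_lact _ x := one_smul k x
  mul_lact _ _ _ _ c c' x := mul_smul (c : k) (c' : k) x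
  ract_one _ x := one_smul Aᵐᵒᵖ x
  ract_mul _ _ _ _ x a a' := mul_smul (op (a' : A)) (op (a : A)) x
  lact_ract _ _ _ _ c x a := smul_comm (op (a : A)) (c : k) x

variable (𝒜) in
/-- The functor `M ↦ M[t, t⁻¹]` from right `A`-modules to graded right `A`-modules. -/
def constGrFunctor : ModuleCat.{u} Aᵐᵒᵖ ⥤ GrMod 𝒜 where
  obj M := constGr 𝒜 M
  map {M N} f := homOfRact (M := constGr 𝒜 M) (N := constGr 𝒜 N)
    (fun _ => f.hom.restrictScalars k) (fun _ x a => f.hom.map_smul (op (a : A)) x)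

instance : (constGrFunctor 𝒜).Additive where
  map_add := rfl

lemma constGrFunctor_exact : PreservesFiniteLimits (constGrFunctor 𝒜) ∧
    PreservesFiniteColimits (constGrFunctor 𝒜) :=
  ((constGrFunctor 𝒜).exact_tfae.out 1 3).1 fun (S : ShortComplex (ModuleCat.{u} Aᵐᵒᵖ)) hS =>
    (exact_iff (S.map (constGrFunctor 𝒜))).2 fun _ => (S.moduleCat_exact_iff).1 hS

instance : PreservesFiniteLimits (constGrFunctor 𝒜) := constGrFunctor_exact.1
instance : PreservesFiniteColimits (constGrFunctor 𝒜) := constGrFunctor_exact.2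

end Const

/-! ### Injective modules give injective graded modules -/

section Coinduced

/-- The right `A`-module `Hom_k(A, E)` coinduced from a vector space. -/
def Coind (k A : Type u) [Field k] [Ring A] [Algebra k A] (E : Type u) [AddCommGroup E]
    [Module k E] : Type u := A →ₗ[k] E

variable {E : Type u} [AddCommGroup E] [Module k E]

instance : AddCommGroup (Coind k A E) := inferInstanceAs (AddCommGroup (A →ₗ[k] E))

instance : SMul Aᵐᵒᵖ (Coind k A E) :=
  ⟨fun a (f : A →ₗ[k] E) => (f.comp (LinearMap.mulLeft k a.unop) : A →ₗ[k] E)⟩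

instance : Module Aᵐᵒᵖ (Coind k A E) where
  one_smul (f : A →ₗ[k] E) := LinearMap.ext fun x => congrArg f (one_mul x)
  mul_smul a b (f : A →ₗ[k] E) := LinearMap.ext fun x => congrArg f (mul_assoc b.unop a.unop x)
  smul_zero _ := rfl
  smul_add _ _ _ := rfl
  add_smul a b (f : A →ₗ[k] E) := LinearMap.ext fun x =>
    (congrArg f (add_mul a.unop b.unop x)).trans (map_add f _ _)
  zero_smul (f : A →ₗ[k] E) := LinearMap.ext fun x => (congrArg f (zero_mul x)).trans (map_zero f)

end Coinduced

section ConstInjective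

variable [GradedAlgebra 𝒜] (E : ModuleCat.{u} Aᵐᵒᵖ)

/-- An injective right module is a direct summand of `Hom_k(A, E)`. -/
lemma exists_retraction_coind [Injective E] :
    ∃ r : Coind k A E →ₗ[Aᵐᵒᵖ] E, ∀ (e : E) (f : A →ₗ[k] E), (∀ a, f a = op a • e) →
      r f = e := by
  let η : E →ₗ[Aᵐᵒᵖ] Coind k A E :=
    { toFun := fun e => (LinearMap.mk
        { toFun := fun a => op a • e
          map_add' := fun a b => add_smul (op a) (op b) e }
        (fun r a => smul_assoc r (op a) e) : A →ₗ[k] E)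
      map_add' := fun e e' => LinearMap.ext (M := A) fun a => smul_add (op a) e e'
      map_smul' := fun b e => LinearMap.ext (M := A) fun a =>
        (mul_smul (op a) b e).symm }
  have hη : Mono (ModuleCat.ofHom η) := (ModuleCat.mono_iff_injective _).2 fun e e' h => by
    have h1 := LinearMap.congr_fun (M := A) h (1 : A)
    exact (one_smul Aᵐᵒᵖ e).symm.trans (h1.trans (one_smul Aᵐᵒᵖ e'))
  refine ⟨(Injective.factorThru (𝟙 E) (ModuleCat.ofHom η)).hom, fun e f hf => ?_⟩
  have h1 : f = η e := LinearMap.ext hf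
  have h2 := Injective.comp_factorThru (𝟙 E) (ModuleCat.ofHom η)
  rw [h1]
  exact congrArg (fun t => t.hom e) h2

variable {E} in
/-- The linear map on `A` assembled from the components of a homogeneous element of a coinduced
graded module. -/
def assemble {n : ℤ} (F : (cofree (ground k) 𝒜 (fun _ => E)).X n) : A →ₗ[k] E :=
  (DirectSum.toModule k ℤ E (fun j => F.1 0 j (n + j) (grOne (ground k)))).comp
    (DirectSum.decomposeLinearEquiv 𝒜).toLinearMap

variable {E} in
lemma assemble_coe {n j : ℤ} (F : (cofree (ground k) 𝒜 (fun _ => E)).X n) (a : 𝒜 j) :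
    assemble F (a : A) = F.1 0 j (n + j) (grOne (ground k)) a := by
  rw [assemble, LinearMap.comp_apply, LinearEquiv.coe_coe, DirectSum.decomposeLinearEquiv_apply,
    DirectSum.decompose_coe]
  exact DirectSum.toModule_lof (M := fun i => 𝒜 i) k j a

/-- Linear maps on a graded algebra agree if they agree on homogeneous elements. -/
lemma linearMap_ext_homogeneous {M : Type*} [AddCommGroup M] [Module k M] {f g : A →ₗ[k] M}
    (h : ∀ (j : ℤ) (a : 𝒜 j), f a = g a) : f = g := by
  refine LinearMap.ext fun x => ?_
  induction x using DirectSum.Decomposition.inductionOn 𝒜 with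
  | zero => rw [map_zero, map_zero]
  | homogeneous a => exact h _ a
  | add a b ha hb => rw [map_add, map_add, ha, hb]

variable {E} in
/-- An `A`-linear retraction `Hom_k(A, E) → E` induces a morphism from the graded module coinduced
from `E` to `E[t, t⁻¹]`. -/
def cofreeToConst (r : Coind k A E →ₗ[Aᵐᵒᵖ] E) :
    cofree (ground k) 𝒜 (fun _ => E) ⟶ constGr 𝒜 E :=
  homOfRact
    (fun n =>
      { toFun := fun F => r (assemble F)
        map_add' := fun F G => by
          refine Eq.trans ?_ (r.map_add (assemble F) (assemble G))
          exact congrArg r (linearMap_ext_homogeneous (𝒜 := 𝒜) fun j a => by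
            change assemble (F + G) (a : A) = assemble F (a : A) + assemble G (a : A)
            rw [assemble_coe, assemble_coe, assemble_coe]; rfl)
        map_smul' := fun c F => by
          refine Eq.trans ?_ (r.map_smul (algebraMap k Aᵐᵒᵖ c) (assemble F))
          exact congrArg r (linearMap_ext_homogeneous (𝒜 := 𝒜) fun j a => by
            change assemble (c • F) (a : A) = assemble F (algebraMap k A c * (a : A))
            rw [← Algebra.smul_def, map_smul, assemble_coe, assemble_coe]; rfl) })
    (fun {s j n} h F a => by
      subst h
      refine Eq.trans ?_ (r.map_smul (op (a : A)) (assemble F))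
      refine congrArg r (linearMap_ext_homogeneous (𝒜 := 𝒜) fun i b => ?_)
      have e : assemble F ((a : A) * (b : A)) =
          F.1 0 (j + i) (s + (j + i)) (grOne (ground k)) (grMul 𝒜 rfl a b) :=
        assemble_coe F (grMul 𝒜 rfl a b)
      refine Eq.trans ?_ e.symm
      rw [assemble_coe, cofree_ract_apply, add_assoc])

/-- The functor `M ↦ M[t, t⁻¹]` preserves injective objects. -/
lemma injective_constGr (_ : Injective E) : Injective ((constGrFunctor 𝒜).obj E) := by
  obtain ⟨r, hr⟩ := exists_retraction_coind (k := k) E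
  refine Retract.injective (Y := cofree (ground k) 𝒜 (fun _ => E))
    ⟨cofreeLift (M := constGr 𝒜 E) fun _ => LinearMap.id, cofreeToConst r, ?_⟩
  refine hom_ext fun n (x : E) => hr x _ fun a => ?_
  let F : (cofree (ground k) 𝒜 (fun _ => E)).X n :=
    app (cofreeLift (𝒞 := ground k) (𝒜 := 𝒜) (M := constGr 𝒜 E) fun _ => LinearMap.id) n x
  let ev : A →ₗ[k] E := LinearMap.mk
    { toFun := fun a => op a • x
      map_add' := fun a b => add_smul (op a) (op b) x }
    (fun r a => smul_assoc r (op a) x)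
  have : assemble F = ev := linearMap_ext_homogeneous (𝒜 := 𝒜) fun j a => by
    rw [assemble_coe]
    exact (cofreeLiftAux_apply (M := constGr 𝒜 E) (fun _ => LinearMap.id) x (zero_add n) rfl
      (grOne (ground k)) a).trans
      (congrArg (fun y : E => op (a : A) • y) ((constGr 𝒜 E).one_lact (zero_add n) x))
  exact LinearMap.congr_fun this a

end ConstInjective

end ASReg


namespace ASReg

open GrBimod MulOpposite
open scoped ModuleCat

variable {k : Type u} [Field k] {A : Type u} [Ring A] [Algebra k A]
  {𝒜 : ℤ → Submodule k A}

/-! ### Vanishing above the global dimension -/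

section Ungraded

/-- A cocycle annihilated by `A_{≥ 1}` in an injective resolution is a map from `A / A_{≥ 1} A`,
so beyond the global dimension it is the coboundary of an element annihilated by `A_{≥ 1}`. -/
lemma exists_annihilated_preimage {d : ℕ} (hd : gldim (ModuleCat.{u} Aᵐᵒᵖ) ≤ d)
    {M : ModuleCat.{u} Aᵐᵒᵖ} (I : InjectiveResolution M) {p q : ℕ} (hpq : p + 1 = q) (hq : d < q)
    (x : I.cocomplex.X q) (hx : (I.cocomplex.d q (q + 1)).hom x = 0)
    (hxA : ∀ (j : ℤ) (a : 𝒜 j), 1 ≤ j → op (a : A) • x = 0) :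
    ∃ y : I.cocomplex.X p, (I.cocomplex.d p q).hom y = x ∧
      ∀ (j : ℤ) (a : 𝒜 j), 1 ≤ j → op (a : A) • y = 0 := by
  let P : Submodule Aᵐᵒᵖ Aᵐᵒᵖ := Submodule.span Aᵐᵒᵖ {b | ∃ j : ℤ, 1 ≤ j ∧ b.unop ∈ 𝒜 j}
  let S : ModuleCat.{u} Aᵐᵒᵖ := ModuleCat.of Aᵐᵒᵖ (Aᵐᵒᵖ ⧸ P)
  have hP : P ≤ LinearMap.ker (LinearMap.toSpanSingleton Aᵐᵒᵖ (I.cocomplex.X q) x) := by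
    refine Submodule.span_le.2 ?_
    rintro b ⟨j, hj, hb⟩
    exact hxA j ⟨b.unop, hb⟩ hj
  let f : S ⟶ I.cocomplex.X q := ModuleCat.ofHom (P.liftQ _ hP)
  have hf : f ≫ I.cocomplex.d q (q + 1) = 0 := by
    refine ModuleCat.hom_ext (LinearMap.ext fun s => ?_)
    obtain ⟨b, rfl⟩ := P.mkQ_surjective s
    change (I.cocomplex.d q (q + 1)).hom (b • x) = 0
    rw [map_smul, hx, smul_zero]
  have hS : HasProjectiveDimensionLE S d :=
    (projectiveDimension_le_iff S d).1 ((le_iSup (fun M => projectiveDimension M) S).trans hd)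
  obtain ⟨g, hg⟩ := (I.extMk_eq_zero_iff f (q + 1) rfl hf p hpq).1
    (Abelian.Ext.eq_zero_of_hasProjectiveDimensionLT _ (d + 1) hq)
  refine ⟨g.hom (P.mkQ 1), ?_, fun j a hj => ?_⟩
  · have h1 := congrArg (fun t => t.hom (P.mkQ 1)) hg
    exact h1.trans (one_smul Aᵐᵒᵖ x)
  · rw [← map_smul, ← map_smul]
    have h1 : P.mkQ (op (a : A) • (1 : Aᵐᵒᵖ)) = 0 := by
      rw [Submodule.mkQ_apply, Submodule.Quotient.mk_eq_zero, smul_eq_mul, mul_one]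
      exact Submodule.subset_span ⟨j, hj, a.2⟩
    rw [h1, map_zero]

end Ungraded

section Graded

variable [GradedAlgebra 𝒜]

variable (𝒜) in
/-- The inclusion of the graded right module `A` into `A[t, t⁻¹]`. -/
def selfToConst : (toRight 𝒜 𝒜).obj (self 𝒜) ⟶
    (constGrFunctor 𝒜).obj (ModuleCat.of Aᵐᵒᵖ A) :=
  homOfRact (M := (toRight 𝒜 𝒜).obj (self 𝒜)) (N := constGr 𝒜 (ModuleCat.of Aᵐᵒᵖ A))
    (fun n =>
      { toFun := fun (a : 𝒜 n) => (a : A)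
        map_add' := fun _ _ => rfl
        map_smul' := fun r (a : 𝒜 n) => by
          change r • (a : A) = (a : A) * algebraMap k A r
          rw [Algebra.smul_def, Algebra.commutes] })
    (fun _ _ _ => rfl)

variable (𝒜) in
/-- The projections onto the homogeneous components form a retraction of the inclusion of `A` into
`A[t, t⁻¹]`. -/
def constToSelf : (constGrFunctor 𝒜).obj (ModuleCat.of Aᵐᵒᵖ A) ⟶
    (toRight 𝒜 𝒜).obj (self 𝒜) :=
  homOfRact (M := constGr 𝒜 (ModuleCat.of Aᵐᵒᵖ A)) (N := (toRight 𝒜 𝒜).obj (self 𝒜))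
    (fun n =>
      { toFun := fun (a : A) => DirectSum.decompose 𝒜 a n
        map_add' := fun (a b : A) => by
          change DirectSum.decompose 𝒜 (a + b) n = _
          rw [DirectSum.decompose_add]; rfl
        map_smul' := fun r (a : A) => by
          change DirectSum.decompose 𝒜 (a * algebraMap k A r) n = _
          rw [← Algebra.commutes, ← Algebra.smul_def, DirectSum.decompose_smul]; rfl })
    (fun {i j n} h (x : A) a => Subtype.ext (by
      subst h
      exact DirectSum.coe_decompose_mul_add_of_right_mem 𝒜 a.2))

lemma selfToConst_constToSelf : selfToConst 𝒜 ≫ constToSelf 𝒜 = 𝟙 _ :=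
  hom_ext fun n (a : 𝒜 n) => Subtype.ext (DirectSum.decompose_of_mem_same 𝒜 a.2)

variable [NatGraded 𝒜]

variable (𝒜) in
/-- The graded right module `R(-m)`. -/
def degZeroShift (m : ℤ) : GrMod 𝒜 := (toRight 𝒜 𝒜).obj ((degZero 𝒜).shift (-m))

variable (𝒜) in
/-- The generator of `R(-m)`, of degree `m`. -/
def degZeroGen (m : ℤ) : (degZeroShift 𝒜 m).X m :=
  show (degZero 𝒜).X (-m + m) from (show (0 : ℤ) = -m + m by omega) ▸ degZeroOne 𝒜

lemma degZeroGen_ract {m n : ℤ} (h : m + (-m + n) = n) (a : 𝒜 (-m + n)) :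
    (degZeroShift 𝒜 m).ract h (degZeroGen 𝒜 m) a = app (degZeroπ 𝒜) (-m + n) a := by
  have key : ∀ (i j : ℤ) (h0 : 0 = i) (h' : i + j = j) (a : 𝒜 j),
      (degZero 𝒜).ract h' (h0 ▸ degZeroOne 𝒜) a = app (degZeroπ 𝒜) j a := by
    rintro _ j rfl h' a
    exact degZeroOne_ract h' a
  exact key (-m + m) (-m + n) (by omega) (by omega) a

lemma isSocle_degZeroGen (m : ℤ) : IsSocle (degZeroShift 𝒜 m) (degZeroGen 𝒜 m) := by
  have key : ∀ (i j j' : ℤ) (h0 : 0 = i) (h' : i + j = j') (a : 𝒜 j), 1 ≤ j →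
      (degZero 𝒜).ract h' (h0 ▸ degZeroOne 𝒜) a = 0 := by
    rintro _ j j' rfl h' a hj
    obtain rfl : j = j' := by omega
    rw [degZeroOne_ract, degZero_π_eq_zero hj]
  exact fun j n h a hj => key (-m + m) j (-m + n) (by omega) (by omega) a hj

lemma degZeroShift_hom_ext {m : ℤ} {M : GrMod 𝒜} {f g : degZeroShift 𝒜 m ⟶ M}
    (h : app f m (degZeroGen 𝒜 m) = app g m (degZeroGen 𝒜 m)) : f = g := by
  refine hom_ext fun n r => ?_
  obtain ⟨a, rfl⟩ := degZeroπ_surjective (-m + n) r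
  have hr := degZeroGen_ract (show m + (-m + n) = n by omega) a
  have hf := app_ract f (show m + (-m + n) = n by omega) (degZeroGen 𝒜 m) a
  have hg := app_ract g (show m + (-m + n) = n by omega) (degZeroGen 𝒜 m) a
  rw [hr] at hf hg
  exact hf.trans ((congrArg (fun t => M.ract _ t a) h).trans hg.symm)

lemma exists_degZeroShift_hom {m : ℤ} {M : GrMod 𝒜} (x : M.X m) (hx : IsSocle M x) :
    ∃ f : degZeroShift 𝒜 m ⟶ M, app f m (degZeroGen 𝒜 m) = x := by
  obtain ⟨f, hf⟩ := exists_evalOne_eq M (⟨x, hx.mem_torsion⟩ : (torsion M).carrier m)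
    fun j n h a hj => Subtype.ext (hx j n h a hj)
  replace hf : f.1 0 m (degZeroOne 𝒜) = x := congrArg Subtype.val hf
  refine ⟨homOfRact (M := degZeroShift 𝒜 m) (fun n => f.1 (-m + n) n)
    fun {i j n} h r a => f.2.2 (-m + i) i j (-m + n) n (by omega) h r a, ?_⟩
  have key : ∀ (i : ℤ) (h0 : 0 = i), f.1 i m (h0 ▸ degZeroOne 𝒜) = x := by
    rintro _ rfl
    exact hf
  exact key _ _

/-- `Ext` from `R(-m)` to `M[t, t⁻¹]` vanishes above the global dimension of the ungraded
algebra. -/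
lemma ext_constGr_eq_zero [HasExt.{u} (GrMod 𝒜)] {d : ℕ}
    (hd : gldim (ModuleCat.{u} Aᵐᵒᵖ) ≤ d) (m : ℤ) (M : ModuleCat.{u} Aᵐᵒᵖ) {p q : ℕ}
    (hpq : p + 1 = q) (hq : d < q)
    (e : Abelian.Ext (degZeroShift 𝒜 m) ((constGrFunctor 𝒜).obj M) q) : e = 0 := by
  let I := InjectiveResolution.of M
  let J := I.mapOfExact (constGrFunctor 𝒜) injective_constGr
  obtain ⟨f, hf, rfl⟩ := J.extMk_surjective e (q + 1) rfl
  rw [J.extMk_eq_zero_iff f (q + 1) rfl hf p hpq]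
  let x : I.cocomplex.X q := app f m (degZeroGen 𝒜 m)
  have hx := (isSocle_degZeroGen m).map f
  obtain ⟨y, hy, hyA⟩ := exists_annihilated_preimage (𝒜 := 𝒜) hd I hpq hq x
    (congrArg (fun t => app t m (degZeroGen 𝒜 m)) hf)
    (fun j a hj => hx j (m + j) rfl a hj)
  obtain ⟨g, hg⟩ := exists_degZeroShift_hom (M := J.cocomplex.X p) (m := m) y
    fun j _ _ a hj => hyA j a hj
  refine ⟨g, degZeroShift_hom_ext ?_⟩
  rw [GrBimod.comp_apply, hg]
  exact hy

/-- Beyond the global dimension, a cocycle of the socle of an injective resolution of `A` is the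
coboundary of an element of the socle. -/
lemma exists_socle_preimage {d : ℕ} (hd : gldim (ModuleCat.{u} Aᵐᵒᵖ) ≤ d)
    (I : InjectiveResolution (self 𝒜)) {p q : ℕ} (hpq : p + 1 = q) (hq : d < q) {m : ℤ}
    (x : (I.cocomplex.X q).X m) (hx : app (I.cocomplex.d q (q + 1)) m x = 0)
    (hxA : IsSocle (I.cocomplex.X q) x) :
    ∃ y, IsSocle (I.cocomplex.X p) y ∧ app (I.cocomplex.d p q) m y = x := by
  have : HasExt.{u} (GrMod 𝒜) := hasExt_of_enoughInjectives _
  let J := I.mapOfExact (toRight 𝒜 𝒜) injective_toRight_obj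
  obtain ⟨f, hf⟩ := exists_degZeroShift_hom (M := J.cocomplex.X q) x hxA
  have hfd : f ≫ J.cocomplex.d q (q + 1) = 0 := degZeroShift_hom_ext (by
    rw [GrBimod.comp_apply, hf]; exact hx)
  have he : J.extMk f (q + 1) rfl hfd = 0 := by
    have h1 := ext_constGr_eq_zero hd m (ModuleCat.of Aᵐᵒᵖ A) hpq hq
      ((J.extMk f (q + 1) rfl hfd).comp (Abelian.Ext.mk₀ (selfToConst 𝒜)) (add_zero q))
    rw [← Abelian.Ext.comp_mk₀_id (J.extMk f (q + 1) rfl hfd), ← selfToConst_constToSelf,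
      ← Abelian.Ext.mk₀_comp_mk₀, ← Abelian.Ext.comp_assoc_of_second_deg_zero, h1,
      Abelian.Ext.zero_comp]
  obtain ⟨g, hg⟩ := (J.extMk_eq_zero_iff f (q + 1) rfl hfd p hpq).1 he
  exact ⟨app g m (degZeroGen 𝒜 m), (isSocle_degZeroGen m).map g,
    (congrArg (fun t => app t m (degZeroGen 𝒜 m)) hg).trans hf⟩

end Graded

end ASReg


namespace ASReg

open GrBimod

variable {k : Type u} [Field k] {A C : Type u} [Ring A] [Algebra k A] [Ring C] [Algebra k C]
  {𝒞 : ℤ → Submodule k C} [SetLike.GradedMonoid 𝒞] {𝒜 : ℤ → Submodule k A}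

/-! ### Subobjects concentrated in one degree -/

section OneDegree

variable [SetLike.GradedMonoid 𝒜]

lemma isZero_iff {M : GrBimod 𝒞 𝒜} : IsZero M ↔ ∀ n (x : M.X n), x = 0 := by
  rw [IsZero.iff_id_eq_zero]
  exact ⟨fun h n x => congrArg (fun t => app t n x) h, fun h => hom_ext h⟩

lemma app_hom_eq_zero_iff {M N : GrBimod 𝒞 𝒜} (e : M ≅ N) {n : ℤ} (x : M.X n) :
    app e.hom n x = 0 ↔ x = 0 :=
  ⟨fun h => injective_of_mono e.hom n (h.trans (map_zero _).symm), fun h => by rw [h, map_zero]⟩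

/-- A monomorphism identifying `M` with the full degree-`c` component of `N`. -/
structure IsComponent {M N : GrBimod 𝒞 𝒜} (f : M ⟶ N) (c : ℤ) : Prop where
  injective : ∀ n, Function.Injective (app f n)
  mem_range_iff : ∀ n (y : N.X n), (∃ x, app f n x = y) ↔ n = c ∨ y = 0

lemma IsComponent.comp_iso {M N P : GrBimod 𝒞 𝒜} {f : M ⟶ N} {c : ℤ} (hf : IsComponent f c)
    (e : N ≅ P) : IsComponent (f ≫ e.hom) c where
  injective n := (injective_of_mono e.hom n).comp (hf.injective n)
  mem_range_iff n y := by
    obtain ⟨y, rfl⟩ := surjective_of_epi e.hom n y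
    rw [app_hom_eq_zero_iff, ← hf.mem_range_iff]
    exact exists_congr fun x => (injective_of_mono e.hom n).eq_iff

lemma IsComponent.nonempty_iso {M N P : GrBimod 𝒞 𝒜} {f : M ⟶ N} {g : P ⟶ N} {c : ℤ}
    (hf : IsComponent f c) (hg : IsComponent g c) : Nonempty (M ≅ P) := by
  have h1 : ∀ n x, app f n x ∈ LinearMap.range (app g n) := fun n x =>
    (hg.mem_range_iff n _).2 ((hf.mem_range_iff n _).1 ⟨x, rfl⟩)
  have h2 : ∀ n x, app g n x ∈ LinearMap.range (app f n) := fun n x =>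
    (hf.mem_range_iff n _).2 ((hg.mem_range_iff n _).1 ⟨x, rfl⟩)
  have := mono_of_injective f hf.injective
  have := mono_of_injective g hg.injective
  exact ⟨⟨liftInj g hg.injective f h1, liftInj f hf.injective g h2,
    by rw [← cancel_mono f, Category.assoc, liftInj_comp, liftInj_comp, Category.id_comp],
    by rw [← cancel_mono g, Category.assoc, liftInj_comp, liftInj_comp, Category.id_comp]⟩⟩

lemma isZero_toRight_iff {M : GrBimod 𝒞 𝒜} : IsZero ((toRight 𝒞 𝒜).obj M) ↔ IsZero M :=
  isZero_iff.trans (isZero_iff (M := M)).symm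

lemma isZero_toLeft_iff {M : GrBimod 𝒞 𝒜} : IsZero ((toLeft 𝒞 𝒜).obj M) ↔ IsZero M :=
  isZero_iff.trans (isZero_iff (M := M)).symm

lemma isSocle_iff_of_iso {M N : GrBimod 𝒞 𝒜} (e : M ≅ N) {n : ℤ} (x : M.X n) :
    IsSocle M x ↔ IsSocle N (app e.hom n x) :=
  ⟨IsSocle.map e.hom, fun h j m hm a hj => injective_of_mono e.hom m (by
    rw [app_ract, h j m hm a hj, map_zero])⟩

lemma IsComponent.toRight {M N : GrBimod 𝒞 𝒜} {f : M ⟶ N} {c : ℤ} (hf : IsComponent f c) :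
    IsComponent ((toRight 𝒞 𝒜).map f) c := ⟨hf.injective, hf.mem_range_iff⟩

lemma IsComponent.toLeft {M N : GrBimod 𝒞 𝒜} {f : M ⟶ N} {c : ℤ} (hf : IsComponent f c) :
    IsComponent ((toLeft 𝒞 𝒜).map f) c := ⟨hf.injective, hf.mem_range_iff⟩

end OneDegree

/-! ### The graded duals of `A` and `R` -/

section Dual

variable [SetLike.GradedMonoid 𝒜] [NatGraded 𝒜]

variable (𝒜) in
/-- The inclusion `DR(ℓ) → DA(ℓ)` dual to the projection `A → R`. -/
def dualDegZeroInclusion (ℓ : ℤ) :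
    (dual (degZero 𝒜)).shift ℓ ⟶ (dual (self 𝒜)).shift ℓ :=
  { app := fun n => (app (degZeroπ 𝒜) (-(ℓ + n))).lcomp k k
    map_lact := fun {i j n} h a (φ : (degZero 𝒜).X (-(ℓ + j)) →ₗ[k] k) =>
      LinearMap.ext fun (x : 𝒜 (-(ℓ + n))) => congrArg φ
        (app_ract (degZeroπ 𝒜) (show -(ℓ + n) + i = -(ℓ + j) by omega) x a).symm
    map_ract := fun {i j n} h (φ : (degZero 𝒜).X (-(ℓ + i)) →ₗ[k] k) a =>
      LinearMap.ext fun (x : 𝒜 (-(ℓ + n))) => congrArg φ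
        (app_lact (degZeroπ 𝒜) (show j + -(ℓ + n) = -(ℓ + i) by omega) a x).symm :
        Hom _ _ }

lemma isComponent_dualDegZeroInclusion (ℓ : ℤ) :
    IsComponent (dualDegZeroInclusion 𝒜 ℓ) (-ℓ) where
  injective n (φ : (degZero 𝒜).X (-(ℓ + n)) →ₗ[k] k) ψ h := LinearMap.ext fun r => by
    obtain ⟨a, rfl⟩ := degZeroπ_surjective (-(ℓ + n)) r
    exact LinearMap.congr_fun (show φ.comp (app (degZeroπ 𝒜) _) =
      LinearMap.comp (σ₂₃ := RingHom.id k) ψ (app (degZeroπ 𝒜) _) from h) a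
  mem_range_iff n φ := by
    constructor
    · rintro ⟨ψ : (degZero 𝒜).X (-(ℓ + n)) →ₗ[k] k, rfl⟩
      refine or_iff_not_imp_left.2 fun hn => LinearMap.ext fun (a : 𝒜 (-(ℓ + n))) => ?_
      change ψ (app (degZeroπ 𝒜) _ a) = 0
      rcases lt_or_ge (-(ℓ + n)) 0 with h | h
      · have ha : a = 0 := Subtype.ext ((Submodule.mem_bot k).1
          ((NatGraded.eq_bot (𝒜 := 𝒜) _ h).le a.2))
        rw [ha]
        exact (congrArg ψ (map_zero _)).trans (map_zero ψ)
      · rw [degZero_π_eq_zero (by omega)]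
        exact map_zero ψ
    · rintro (rfl | rfl)
      · refine ⟨((augmentation 𝒜).carrier (-(ℓ + -ℓ))).liftQ φ fun a ha => ?_,
          LinearMap.ext fun a => rfl⟩
        rw [mem_augmentation a ha (by omega)]
        exact Submodule.zero_mem _
      · exact ⟨0, map_zero _⟩

/-- The right socle of `DA(ℓ)` is its component of degree `-ℓ`. -/
lemma isSocle_dual_iff (ℓ : ℤ) {n : ℤ} (φ : ((dual (self 𝒜)).shift ℓ).X n) :
    IsSocle ((dual (self 𝒜)).shift ℓ) φ ↔ n = -ℓ ∨ φ = 0 := by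
  change 𝒜 (-(ℓ + n)) →ₗ[k] k at φ
  constructor
  · intro h
    refine or_iff_not_imp_left.2 fun hn => LinearMap.ext fun (a : 𝒜 (-(ℓ + n))) => ?_
    rcases lt_or_ge (-(ℓ + n)) 0 with h' | h'
    · have ha : a = 0 := Subtype.ext ((Submodule.mem_bot k).1
        ((NatGraded.eq_bot (𝒜 := 𝒜) _ h').le a.2))
      rw [ha]
      exact map_zero φ
    · -- The value of `φ` at `a` is the value of `φ a` at `1`.
      have h1 := h (-(ℓ + n)) (-ℓ) (by omega) a (by omega)
      have h2 : ∀ (i : ℤ) (_ : i = 0) (h : -(ℓ + n) + i = -(ℓ + n)) (b : 𝒜 i), (b : A) = 1 →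
          grMul 𝒜 h a b = a := by
        rintro _ rfl h b hb
        exact Subtype.ext (by simp [hb])
      have h3 : (1 : A) ∈ 𝒜 (-(ℓ + -ℓ)) := by
        rw [show -(ℓ + -ℓ) = 0 by omega]; exact SetLike.GradedOne.one_mem
      have h4 : φ (grMul 𝒜 (by omega) a (⟨1, h3⟩ : 𝒜 (-(ℓ + -ℓ)))) = 0 :=
        LinearMap.congr_fun h1 ⟨1, h3⟩
      exact (congrArg φ (h2 _ (by omega) (by omega) ⟨1, h3⟩ rfl)).symm.trans h4
  · rintro (rfl | rfl)
    · intro j m h a hj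
      refine LinearMap.ext fun (b : 𝒜 (-(ℓ + m))) => ?_
      have hb : b = 0 := Subtype.ext ((Submodule.mem_bot k).1
        ((NatGraded.eq_bot (𝒜 := 𝒜) _ (by omega)).le b.2))
      rw [hb]
      exact map_zero _
    · exact fun j m h a _ => by rw [map_zero, LinearMap.zero_apply]

end Dual

/-! ### Comparison of `RHom_A(R, A)` with `RΓ_𝔪(A)` -/

section Comparison

variable [GradedAlgebra 𝒜] [NatGraded 𝒜]

/-- The complex `Hom_A(R, K)`. -/
abbrev homComplex (K : CochainComplex (GrBimod 𝒜 𝒜) ℤ) : CochainComplex (GrBimod 𝒜 𝒜) ℤ :=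
  ((homFunctor 𝒜 (degZero 𝒜)).mapHomologicalComplex (.up ℤ)).obj K

/-- Evaluation at `1`, as a morphism of complexes `Hom_A(R, K) → Γ_𝔪(K)`. -/
def evalComplex (K : CochainComplex (GrBimod 𝒜 𝒜) ℤ) : homComplex K ⟶ gamComplex K :=
  (NatTrans.mapHomologicalComplex (evalOne 𝒜 𝒜) (.up ℤ)).app K

section

variable (K : CochainComplex (GrBimod 𝒜 𝒜) ℤ)

lemma evalComplex_injective (p n : ℤ) : Function.Injective (app ((evalComplex K).f p) n) :=
  evalOne_injective (K.X p) n

lemma isSocle_evalComplex {p n : ℤ} (x : ((homComplex K).X p).X n) :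
    IsSocle ((gamComplex K).X p) (app ((evalComplex K).f p) n x) :=
  isSocle_evalOne (K.X p) x

lemma exists_evalComplex_eq {p n : ℤ} (x : ((gamComplex K).X p).X n)
    (hx : IsSocle ((gamComplex K).X p) x) : ∃ y, app ((evalComplex K).f p) n y = x :=
  exists_evalOne_eq (K.X p) x hx

lemma evalComplex_d {p q n : ℤ} (x : ((homComplex K).X p).X n) :
    app ((evalComplex K).f q) n (app ((homComplex K).d p q) n x) =
      app ((gamComplex K).d p q) n (app ((evalComplex K).f p) n x) := by
  rw [← GrBimod.comp_apply, ← GrBimod.comp_apply, (evalComplex K).comm]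

end

variable {K : CochainComplex (GrBimod 𝒜 𝒜) ℤ}

lemma isZero_homology_homComplex {p q : ℤ} (hpq : p + 1 = q)
    (h : ∀ n x, IsSocle ((gamComplex K).X q) x → app ((gamComplex K).d q (q + 1)) n x = 0 →
      ∃ y, IsSocle ((gamComplex K).X p) y ∧ app ((gamComplex K).d p q) n y = x) :
    IsZero ((homComplex K).homology q) := by
  rw [isZero_homology_iff _ hpq rfl]
  intro n x hx
  obtain ⟨y, hy, hyx⟩ := h n _ (isSocle_evalComplex K x) (by rw [← evalComplex_d, hx, map_zero])
  obtain ⟨y, rfl⟩ := exists_evalComplex_eq K y hy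
  exact ⟨y, evalComplex_injective K q n (by rw [evalComplex_d, hyx])⟩

section LowDegrees

variable [K.IsStrictlyGE 0] (hK : ∀ p, Injective ((toRight 𝒜 𝒜).obj (K.X p))) {d : ℤ}
  (hd : ∀ p < d, IsZero ((gamComplex K).homology p))

include hK hd

lemma isZero_homology_homComplex_of_lt {q : ℤ} (hq : q < d) :
    IsZero ((homComplex K).homology q) := by
  refine isZero_homology_homComplex (show q - 1 + 1 = q by omega) fun n x hx hdx => ?_
  obtain ⟨y, rfl⟩ := (isZero_homology_iff _ (show q - 1 + 1 = q by omega) rfl).1 (hd q hq) n x hdx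
  exact exists_socle_of_boundary hK hd (by omega) hq.le y hx

/-- In the first degree where `Γ_𝔪(K)` may have cohomology, evaluation at `1` identifies the
cohomology of `Hom_A(R, K)` with the right socle of the cohomology of `Γ_𝔪(K)`. -/
lemma homologyMap_evalComplex :
    (∀ n, Function.Injective (app (HomologicalComplex.homologyMap (evalComplex K) d) n)) ∧
      ∀ n h, (∃ g, app (HomologicalComplex.homologyMap (evalComplex K) d) n g = h) ↔
        IsSocle ((gamComplex K).homology d) h := by
  have hd1 : d - 1 + 1 = d := by omega
  refine ⟨fun n => (injective_iff_map_eq_zero _).2 fun g hg => ?_, fun n h => ⟨?_, fun hh => ?_⟩⟩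
  · obtain ⟨z, rfl⟩ := surjective_of_epi ((homComplex K).homologyπ d) n g
    rw [homologyπ_homologyMap, homologyπ_eq_zero_iff _ hd1] at hg
    obtain ⟨y, hy⟩ := hg
    rw [iCycles_cyclesMap] at hy
    obtain ⟨y', hy', hyy'⟩ := exists_socle_of_boundary hK hd hd1 le_rfl y
      (by rw [hy]; exact isSocle_evalComplex K _)
    obtain ⟨y', rfl⟩ := exists_evalComplex_eq K y' hy'
    exact (homologyπ_eq_zero_iff _ hd1 z).2
      ⟨y', evalComplex_injective K d n (by rw [evalComplex_d, hyy', hy])⟩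
  · rintro ⟨g, rfl⟩
    obtain ⟨z, rfl⟩ := surjective_of_epi ((homComplex K).homologyπ d) n g
    rw [homologyπ_homologyMap]
    refine IsSocle.map _ fun j m hm a hj => injective_of_mono ((gamComplex K).iCycles d) m ?_
    rw [app_ract, iCycles_cyclesMap, map_zero]
    exact isSocle_evalComplex K _ j m hm a hj
  · obtain ⟨z, rfl⟩ := surjective_of_epi ((gamComplex K).homologyπ d) n h
    obtain ⟨y, hy⟩ := exists_socle_representative hK hd hd1 le_rfl
      (app ((gamComplex K).iCycles d) n z) fun t m hm a ht => by
        rw [← app_ract, ← homologyπ_eq_zero_iff _ hd1, app_ract]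
        exact hh t m hm a ht
    obtain ⟨w, hw⟩ := exists_evalComplex_eq K _ hy
    obtain ⟨w, rfl⟩ := exists_iCycles_eq (homComplex K) rfl w
      (evalComplex_injective K (d + 1) n (by
        have hz : app ((gamComplex K).d d (d + 1)) n (app ((gamComplex K).iCycles d) n z) = 0 := by
          rw [← GrBimod.comp_apply, (gamComplex K).iCycles_d]; rfl
        rw [evalComplex_d, hw, map_sub, d_d_apply, hz, sub_zero, map_zero]))
    refine ⟨app ((homComplex K).homologyπ d) n w, ?_⟩
    rw [homologyπ_homologyMap, ← sub_eq_zero, ← map_sub, homologyπ_eq_zero_iff _ hd1]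
    refine ⟨-y, ?_⟩
    rw [map_neg, map_sub, iCycles_cyclesMap, hw]
    abel

end LowDegrees

lemma isZero_homology_homComplex_of_gt {d : ℕ} (hd : gldim (ModuleCat.{u} Aᵐᵒᵖ) ≤ d)
    (I : InjectiveResolution (self 𝒜)) {q : ℤ} (hq : d < q) :
    IsZero ((homComplex I.cochainComplex).homology q) := by
  obtain ⟨p, rfl⟩ : ∃ p : ℕ, q = (p + 1 : ℕ) := ⟨(q - 1).toNat, by omega⟩
  refine isZero_homology_homComplex (p := p) (by push_cast; rfl) fun n x hx hdx => ?_
  let e := I.cochainComplexXIso p p rfl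
  let e' := I.cochainComplexXIso (p + 1 : ℕ) (p + 1) rfl
  let e'' := I.cochainComplexXIso ((p + 1 : ℕ) + 1 : ℤ) (p + 1 + 1) (by push_cast; rfl)
  have hx' : IsSocle (I.cochainComplex.X (p + 1 : ℕ)) x.1 := fun j m h a hj =>
    congrArg Subtype.val (hx j m h a hj)
  have hdx' : app (I.cochainComplex.d (p + 1 : ℕ) ((p + 1 : ℕ) + 1)) n x.1 = 0 :=
    congrArg Subtype.val hdx
  obtain ⟨y, hy, hyx⟩ := exists_socle_preimage hd I (p := p) rfl (by omega) (app e'.hom n x.1)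
    (injective_of_mono e''.inv n (by
      rw [map_zero, ← hdx', I.cochainComplex_d _ _ (p + 1) (p + 1 + 1) rfl (by push_cast; rfl)]
      rfl)) (hx'.map e'.hom)
  have hy' := hy.map e.inv
  refine ⟨⟨app e.inv n y, hy'.mem_torsion⟩, fun j m h a hj => Subtype.ext (hy' j m h a hj),
    Subtype.ext ?_⟩
  change app (I.cochainComplex.d p (p + 1 : ℕ)) n (app e.inv n y) = x.1
  rw [I.cochainComplex_d _ _ p (p + 1) rfl rfl]
  change app e'.inv n (app (I.cocomplex.d p (p + 1)) n (app e.hom n (app e.inv n y))) = x.1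
  rw [← GrBimod.comp_apply e.inv e.hom, e.inv_hom_id, app_id, LinearMap.id_apply, hyx,
    ← GrBimod.comp_apply, e'.hom_inv_id, app_id, LinearMap.id_apply]

/-- `H^d(Hom_A(R, K))` is the component of degree `-ℓ` of `H^d(Γ_𝔪(K)) ≅ DA(ℓ)`, and so is `DR(ℓ)`,
for right and for left modules. -/
lemma IsASFRegular.isASRegular {d : ℕ} {ℓ : ℤ} (hA : IsASFRegular 𝒜 d ℓ) :
    IsASRegular 𝒜 d ℓ := by
  refine { toIsLocallyFiniteOfGldim := hA.toIsLocallyFiniteOfGldim, iso := ?_ }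
  let I := InjectiveResolution.of (self 𝒜)
  let K := I.cochainComplex
  obtain ⟨e⟩ := I.nonempty_rightDerivedFunctorPlus_iso (Gam 𝒜 𝒜)
  obtain ⟨e'⟩ := I.nonempty_rightDerivedFunctorPlus_iso (homFunctor 𝒜 (degZero 𝒜))
  obtain ⟨hzero, ⟨er⟩⟩ := (nonempty_mapDerivedCategory_iso_single_shift_iff (toRight 𝒜 𝒜) e
    ((toRight 𝒜 𝒜).obj ((dual (self 𝒜)).shift ℓ)) d).1 hA.iso.right
  obtain ⟨-, ⟨el⟩⟩ := (nonempty_mapDerivedCategory_iso_single_shift_iff (toLeft 𝒜 𝒜) e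
    ((toLeft 𝒜 𝒜).obj ((dual (self 𝒜)).shift ℓ)) d).1 hA.iso.left
  have hK : ∀ p, Injective ((toRight 𝒜 𝒜).obj (K.X p)) := fun p =>
    injective_toRight_obj (K.X p) inferInstance
  have hd : ∀ p < (d : ℤ), IsZero ((gamComplex K).homology p) := fun p hp =>
    isZero_toRight_iff.1 (hzero p hp.ne)
  have hzero' : ∀ p ≠ (d : ℤ), IsZero ((homComplex K).homology p) := fun p hp => by
    rcases lt_or_gt_of_ne hp with h | h
    · exact isZero_homology_homComplex_of_lt hK hd h
    · exact isZero_homology_homComplex_of_gt hA.gldim_eq.le I h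
  obtain ⟨hinj, hrange⟩ := homologyMap_evalComplex hK hd
  have hcomp : IsComponent (HomologicalComplex.homologyMap (evalComplex K) d) (-ℓ) := by
    -- The right socle only involves the right action, so it can be computed in `DA(ℓ)`.
    refine ⟨hinj, fun n h => (hrange n h).trans ((isSocle_iff_of_iso er h).trans
      ((isSocle_dual_iff ℓ (app er.hom n h)).trans
        (or_congr Iff.rfl (app_hom_eq_zero_iff er h))))⟩
  -- Being a component does not involve the actions, so it may be transported along the
  -- isomorphisms of right and of left modules separately.
  have hdual := isComponent_dualDegZeroInclusion (𝒜 := 𝒜) ℓ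
  exact
    { right := (nonempty_mapDerivedCategory_iso_single_shift_iff (toRight 𝒜 𝒜) e' _ d).2
        ⟨fun p hp => isZero_toRight_iff.2 (hzero' p hp),
          (hcomp.toRight.comp_iso er).nonempty_iso hdual.toRight⟩
      left := (nonempty_mapDerivedCategory_iso_single_shift_iff (toLeft 𝒜 𝒜) e' _ d).2
        ⟨fun p hp => isZero_toLeft_iff.2 (hzero' p hp),
          (hcomp.toLeft.comp_iso el).nonempty_iso hdual.toLeft⟩ }

end Comparison

end ASReg

theorem theorem2p14 {k : Type u} [Field k] {A : Type u} [Ring A] [Algebra k A]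
    (𝒜 : ℤ → Submodule k A) [GradedAlgebra 𝒜] [ASReg.NatGraded 𝒜] (d : ℕ) (ℓ : ℤ)
    (hA : ASReg.IsASFRegular 𝒜 d ℓ) (hEF : ASReg.EF 𝒜) :
    ASReg.IsASRegular 𝒜 d ℓ :=
  hA.isASRegular

end
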